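/- **Theorem 3.1 (stability, or vanishing of 1-cohomology).** Let $A$ be an AF algebra, unital or not, i.e. a C*-algebra containing an increasing sequence of finite-dimensional *-subalgebras with dense union. Let $\tilde A=A+\mathbb C1$ be $A$ with a unit adjoined, and extend every automorphism of $A$ to $\tilde A$ by $1\mapsto 1$. (If $A$ is unital, everything below is equivalent to the same text with $1$ read as the unit of $A$ and $\tilde A$ as $A$.) Write $\mathrm{Ad}\,U(x)=UxU^*$. An automorphism $\alpha$ of $A$ has the *Rohlin property* if for every $k\in\mathbb N$ there are positive integers $k_1,\dots,k_m\ge k$ (with $m\geq 1$) such that the following holds. For all projections $E,e\in A$, every unitary $U\in\tilde A$, every finite set $\mathcal F\subset EAE$ and every $\delta>0$ with $$e\le E,\quad \mathrm{Ad}\,U\circ\alpha(e)\le E,\quad e\in\mathcal F,\quad \mathrm{Ad}\,U\circ\alpha(e)\in\mathcal F,$$ there are projections $e_{i,j}\in A$ ($1\le i\le m$, $0\le j\le k_i-1$) such that, with $e_{i,k_i}=e_{i,0}$, $$\sum_{i,j}e_{i,j}=E,\qquad \|\mathrm{Ad}\,U\circ\alpha(e_{i,j}e)-e_{i,j+1}\,\mathrm{Ad}\,U\circ\alpha(e)\|<\delta,\qquad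 \|[x,e_{i,j}]\|<\delta$$ for all $i$, all $0\le j\le k_i-1$ and all $x\in\mathcal F$. Let $\alpha$ be an automorphism of $A$ with the Rohlin property. Then for every $\epsilon>0$ and every finite-dimensional *-subalgebra $B_1$ of $A$ there is a finite-dimensional *-subalgebra $B_2$ of $A$ such that for every unitary $U\in (A\cap B_2')+1$ there is a unitary $V\in (A\cap B_1')+1$ with $$\|U-V\alpha(V^*)\|<\epsilon .$$ Here $(A\cap B')+1=\{a+1 : a\in A,\ ab=ba \text{ for all } b\in B\}\subset\tilde A$. -/

import Mathlib

/-- An AF algebra: a C⋆-algebra containing an increasing sequence of finite-dimensional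
⋆-subalgebras with dense union (no unit is required, in the algebra or in the subalgebras). -/
def IsAFAlgebra (A : Type*) [NonUnitalCStarAlgebra A] : Prop :=
  ∃ B : ℕ → NonUnitalStarSubalgebra ℂ A,
    Monotone B ∧ (∀ n, FiniteDimensional ℂ (B n)) ∧ Dense (⋃ n, (B n : Set A))

/-- `Ad U` acting on `A`, for `U` in the unitization `A + ℂ1`, i.e. `a ↦ U a U⋆`.
As `A` is an ideal, `U a U⋆` lies in `A`; see `coe_adOn`. -/
def adOn {A : Type*} [NonUnitalCStarAlgebra A] (U : Unitization ℂ A) (a : A) : A :=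
  (U * (a : Unitization ℂ A) * star U).snd

theorem coe_adOn {A : Type*} [NonUnitalCStarAlgebra A] (U : Unitization ℂ A) (a : A) :
    (adOn U a : Unitization ℂ A) = U * (a : Unitization ℂ A) * star U := by
  refine Unitization.ext ?_ ?_ <;> simp [adOn]

/-- The Rohlin property of an automorphism `α` of `A`. For projections, `p ≤ E` is expressed as
`E * p = p`, and `x ∈ EAE` as `E * x * E = x`. The towers `p i 0, …, p i (K i - 1)` are indexed
cyclically: `p i (K i) = p i 0`. -/
def HasRohlinProperty {A : Type*} [NonUnitalCStarAlgebra A] (α : A ≃⋆ₐ[ℂ] A) : Prop :=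
  ∀ k : ℕ, ∃ (m : ℕ) (K : Fin m → ℕ), 0 < m ∧ (∀ i, 0 < K i ∧ k ≤ K i) ∧
    ∀ (E e : A) (U : Unitization ℂ A) (F : Finset A) (ε : ℝ),
      IsStarProjection E → IsStarProjection e → U ∈ unitary (Unitization ℂ A) →
      (∀ x ∈ F, E * x * E = x) → 0 < ε →
      E * e = e → E * adOn U (α e) = adOn U (α e) →
      e ∈ F → adOn U (α e) ∈ F →
      ∃ p : Fin m → ℕ → A,
        (∀ i, p i (K i) = p i 0) ∧
        (∀ i, ∀ j < K i, IsStarProjection (p i j)) ∧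
        ∑ i, ∑ j ∈ Finset.range (K i), p i j = E ∧
        (∀ i, ∀ j < K i,
          ‖adOn U (α (p i j * e)) - p i (j + 1) * adOn U (α e)‖ < ε) ∧
        (∀ i, ∀ j < K i, ∀ x ∈ F, ‖x * p i j - p i j * x‖ < ε)

/-- The unitaries of `A + ℂ1` lying in `(A ∩ B') + 1`: those of the form `1 + a` with `a ∈ A`
commuting with every element of `B`. -/
def unitariesOnePlusCommutant {A : Type*} [NonUnitalCStarAlgebra A]
    (B : NonUnitalStarSubalgebra ℂ A) : Set (Unitization ℂ A) :=
  {U | U ∈ unitary (Unitization ℂ A) ∧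
    ∃ a : A, a ∈ Set.centralizer (B : Set A) ∧ U = (a : Unitization ℂ A) + 1}

/-- The canonical extension of an automorphism `α` of `A` to the unitization,
`λ1 + a ↦ λ1 + α(a)`. -/
noncomputable def unitizationExtension {A : Type*} [NonUnitalCStarAlgebra A]
    (α : A ≃⋆ₐ[ℂ] A) : Unitization ℂ A →⋆ₐ[ℂ] Unitization ℂ A :=
  Unitization.starMap (α : A →⋆ₙₐ[ℂ] A)

/-! ### Polar decomposition of almost unitary elements -/

section Polar

variable {D : Type*} [CStarAlgebra D]

/-! The required estimate says that `V` almost solves `V = U α(V)`. Put `U_j = U α(U) ⋯ α^(j-1)(U)`.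
On a tower of `K` projections that `α` almost permutes cyclically, placing `U_j` on level `j` solves
the equation except in the passage from the top to the bottom, where `U_K` meets `1`. This defect is
spread over the tower: if `h` is a path of unitaries from `1` to `α^(-K)(U_K⋆)`, then `X_j = U_j
α^j(h(j/K))` errs at each level by one step of `h`, and at the top `U_K α^K(h(1)) = 1 = X_0`
(`norm_tower_cocycle_sub_le`).

In an AF algebra `h` can be taken `π`-Lipschitz whatever `U` is, once its endpoint is allowed a
small error: the endpoint is close to a unitary in a finite-dimensional subalgebra plus scalars,
which has finite spectrum and so a logarithm of norm at most `π`. If the endpoint almost commutes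
with enough elements, the whole path almost commutes with prescribed ones
(`exists_unitary_path_almost_commuting`).

Gluing over all towers gives `V = 1 + ∑ (X_a - 1) q_a`. Since the projections `q_a` almost commute
with everything involved, `V` is almost unitary, almost solves the equation and almost commutes with
`B₁` (`exists_glued_unitary`). Averaging over the unitaries of `B₁ + ℂ1`, then polar decomposition,
makes `V` unitary and puts it exactly in the commutant (`exists_unitary_in_commutant_near`).

The order of choices is essential: `k` from `ε`, the tower heights from `k`, the commutator
tolerances and `B₂` from the heights, then `U` and the `X_a`, and only then the projections. It is
consistent because the Rohlin heights depend on `k` alone, and because the norm of a block diagonal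
sum is governed by its largest block (`norm_sum_conj_le`), so the error `π/k` is not multiplied by
the number of levels. -/

theorem continuous_starAlgHom_complex (χ : D →⋆ₐ[ℂ] ℂ) : Continuous χ :=
  AddMonoidHomClass.continuous_of_bound χ 1 fun x => by
    simpa using NonUnitalStarAlgHom.norm_apply_le χ x

theorem spectrum_subset_of_norm_sub_one_le {a : D} {δ : ℝ} (h : ‖a - 1‖ ≤ δ) :
    ∀ t ∈ spectrum ℝ a, |t - 1| ≤ δ := by
  intro t ht
  have : Nontrivial D := by
    by_contra hn
    rw [not_nontrivial_iff_subsingleton] at hn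
    simp [spectrum.of_subsingleton] at ht
  have h1 : t - 1 ∈ spectrum ℝ (a - 1) := by
    have := spectrum.sub_singleton_eq a (1 : ℝ)
    rw [map_one] at this
    rw [← this]
    exact Set.sub_mem_sub ht rfl
  exact (spectrum.norm_le_norm_of_mem h1).trans h

theorem abs_inv_sqrt_sub_one_le {t : ℝ} (ht : |t - 1| ≤ 1 / 2) :
    |(√t)⁻¹ - 1| ≤ |t - 1| := by
  have h0 : 1 / 2 ≤ t := by linarith [(abs_le.mp ht).1]
  have h1 : (0.7 : ℝ) ≤ √t := Real.le_sqrt_of_sq_le (by norm_num; linarith)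
  have h2 : √t * √t = t := Real.mul_self_sqrt (by linarith)
  have h3 : (√t)⁻¹ - 1 = (1 - t) * ((√t) * (1 + √t))⁻¹ := by
    field_simp
    nlinarith
  rw [h3, abs_mul, abs_sub_comm]
  refine mul_le_of_le_one_right (abs_nonneg _) ?_
  rw [abs_of_pos (by positivity)]
  exact inv_le_one_of_one_le₀ (by nlinarith)

/-- Polar decomposition of an almost unitary element. -/
theorem exists_unitary_mul_near [Nontrivial D] {z : D} (h1 : ‖star z * z - 1‖ ≤ 1 / 2)
    (h2 : ‖z * star z - 1‖ ≤ 1 / 2) :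
    ∃ r : D, z * r ∈ unitary D ∧ ‖z * r - z‖ ≤ 2 * ‖star z * z - 1‖ ∧
      (∀ c, Commute (star z * z) c → Commute r c) ∧
      (∀ S : StarSubalgebra ℂ D, IsClosed (S : Set D) → z ∈ S → r ∈ S) ∧
      (∀ χ : D →⋆ₐ[ℂ] ℂ, χ z = 1 → χ r = 1) := by
  set a := star z * z with ha
  have hsa : IsSelfAdjoint a := IsSelfAdjoint.star_mul_self z
  have hsp := spectrum_subset_of_norm_sub_one_le h1
  have hpos : ∀ t ∈ spectrum ℝ a, 0 < t := fun t ht => by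
    linarith [(abs_le.mp (hsp t ht)).1]
  have hcont : ContinuousOn (fun t : ℝ => (√t)⁻¹) (spectrum ℝ a) :=
    ContinuousOn.inv₀ (by fun_prop) fun t ht => (Real.sqrt_pos.mpr (hpos t ht)).ne'
  -- `r` is `|z|⁻¹`. As a function of `star z * z`, it inherits commutation, membership in closed
  -- subalgebras and the value of characters.
  set r := cfc (fun t : ℝ => (√t)⁻¹) a with hr
  have hrsa : IsSelfAdjoint r := cfc_predicate _ _
  have hrc : ∀ c, Commute a c → Commute r c := fun c hc => hc.cfc_real _
  have hra : r * a * r = 1 := by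
    have ha' : a = cfc (fun t : ℝ => t) a := (cfc_id' ℝ a).symm
    rw [hr]
    nth_rewrite 2 [ha']
    rw [← cfc_mul _ _ _ hcont (by fun_prop), ← cfc_mul _ _ _ (by fun_prop) hcont]
    rw [show (1 : D) = cfc (fun _ : ℝ => (1 : ℝ)) a from (cfc_const_one ℝ a).symm]
    refine cfc_congr fun t ht => ?_
    have h0 := Real.sqrt_pos.mpr (hpos t ht)
    have h2 : √t * √t = t := Real.mul_self_sqrt (hpos t ht).le
    field_simp
    nlinarith
  have hr1 : ‖r - 1‖ ≤ ‖a - 1‖ := by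
    rw [hr, show (1 : D) = cfc (fun _ : ℝ => (1 : ℝ)) a from (cfc_const_one ℝ a).symm,
      ← cfc_sub _ _ _ hcont (by fun_prop)]
    refine norm_cfc_le (norm_nonneg _) fun t ht => ?_
    rw [Real.norm_eq_abs, cfc_const_one ℝ a]
    exact (abs_inv_sqrt_sub_one_le ((hsp t ht))).trans
      (spectrum_subset_of_norm_sub_one_le le_rfl t ht)
  have hz : ‖z‖ ≤ 2 := by
    have h3 : ‖z‖ * ‖z‖ = ‖a‖ := by rw [ha, CStarRing.norm_star_mul_self]
    have h4 : ‖a‖ ≤ ‖a - 1‖ + ‖(1 : D)‖ := by simpa using norm_add_le (a - 1) 1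
    rw [CStarRing.norm_one] at h4
    nlinarith [norm_nonneg z]
  have hu1 : star (z * r) * (z * r) = 1 := by
    rw [star_mul, hrsa.star_eq, ← hra, ha]; noncomm_ring
  have hu2 : z * r * star (z * r) = 1 := by
    -- `z * r` is so far only an isometry; its range projection fixes `z * star z`, and
    -- invertibility of the latter forces it to be `1`.
    have hunit : IsUnit (z * star z) := by
      have := isUnit_one_sub_of_norm_lt_one (x := 1 - z * star z)
        (by rw [norm_sub_rev]; linarith)
      simpa using this
    have h3 : z * r * star (z * r) * (z * star z) = z * star z := by
      have : r * (r * a) = 1 := by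
        rw [(hrc a (Commute.refl a)).eq, ← mul_assoc, hra]
      calc z * r * star (z * r) * (z * star z) = z * (r * (r * a)) * star z := by
            rw [star_mul, hrsa.star_eq, ha]; noncomm_ring
        _ = _ := by rw [this, mul_one]
    exact hunit.mul_eq_right.mp h3
  refine ⟨r, Unitary.mem_iff.mpr ⟨hu1, hu2⟩, ?_, hrc, fun S hS hzS => ?_, fun χ hχ => ?_⟩
  · calc ‖z * r - z‖ = ‖z * (r - 1)‖ := by rw [mul_sub, mul_one]
      _ ≤ ‖z‖ * ‖r - 1‖ := norm_mul_le _ _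
      _ ≤ 2 * ‖a - 1‖ := by gcongr
  · exact cfc_mem (s := S) (hs := hS) _ (mul_mem (star_mem hzS) hzS)
  · have h3 : χ a = 1 := by rw [ha, map_mul, map_star, hχ]; simp
    have hχc := continuous_starAlgHom_complex χ
    rw [hr, StarAlgHomClass.map_cfc (S := ℂ) χ _ a hcont hχc hsa (by rw [h3]; simp), h3,
      ← map_one (algebraMap ℝ ℂ),
      cfc_algebraMap]
    simp

end Polar

/-! ### Unitary equivalence of close projections -/

section Projections

variable {D : Type*} [CStarAlgebra D]

theorem IsStarProjection.norm_le_one {p : D} (hp : IsStarProjection p) : ‖p‖ ≤ 1 := by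
  have h : ‖p‖ * ‖p‖ = ‖p‖ := by
    rw [← CStarRing.norm_star_mul_self, hp.isSelfAdjoint.star_eq, hp.isIdempotentElem.eq]
  nlinarith [norm_nonneg p]

/-- Close projections are conjugate by a unitary close to `1`. -/
theorem exists_unitary_conj_of_close_projections [Nontrivial D] {p q : D} (hp : IsStarProjection p)
    (hq : IsStarProjection q) (h : ‖q - p‖ ≤ 1 / 20) :
    ∃ U ∈ unitary D, U * p * star U = q ∧ ‖U - 1‖ ≤ 20 * ‖q - p‖ := by
  set δ := ‖q - p‖ with hδ
  have hδ0 : 0 ≤ δ := norm_nonneg _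
  have hpp := hp.isIdempotentElem.eq
  have hqq := hq.isIdempotentElem.eq
  have hps := hp.isSelfAdjoint.star_eq
  have hqs := hq.isSelfAdjoint.star_eq
  -- `z` intertwines `p` and `q` and is near `1`. Its absolute value commutes with `p`, so the
  -- unitary part still intertwines.
  set z := q * p + (1 - q) * (1 - p) with hz
  have hn1 := hp.norm_le_one
  have hn2 := hp.one_sub.norm_le_one
  have hz1 : ‖z - 1‖ ≤ 2 * δ := by
    have : z - 1 = (q - p) * p - (q - p) * (1 - p) := by
      rw [hz]; simp only [mul_sub, sub_mul, mul_one, one_mul, hpp]; abel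
    rw [this]
    refine (norm_sub_le _ _).trans ?_
    have h1 := norm_mul_le (q - p) p
    have h2 := norm_mul_le (q - p) (1 - p)
    nlinarith
  have hz1' : ‖star z - 1‖ ≤ 2 * δ := by
    rw [← star_one, ← star_sub, norm_star]; exact hz1
  have hzn : ‖z‖ ≤ 1.1 := by
    have := norm_add_le (z - 1) 1
    rw [sub_add_cancel, CStarRing.norm_one] at this
    linarith
  have hzz : ‖star z * z - 1‖ ≤ 5 * δ := by
    have : star z * z - 1 = (star z - 1) * z + (z - 1) := by noncomm_ring
    rw [this]
    refine (norm_add_le _ _).trans ?_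
    have := norm_mul_le (star z - 1) z
    nlinarith [norm_nonneg z]
  have hzz' : ‖z * star z - 1‖ ≤ 5 * δ := by
    have : z * star z - 1 = z * (star z - 1) + (z - 1) := by noncomm_ring
    rw [this]
    refine (norm_add_le _ _).trans ?_
    have := norm_mul_le z (star z - 1)
    nlinarith [norm_nonneg z]
  have hsz : star z = p * q + (1 - p) * (1 - q) := by
    simp [hz, hps, hqs]
  have hzp : z * p = q * z := by
    rw [hz]; simp only [mul_sub, sub_mul, mul_one, one_mul, hpp, mul_add, add_mul, mul_assoc]
    simp only [← mul_assoc, hqq]; abel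
  have hszp : p * star z = star z * q := by
    have := congrArg star hzp
    rwa [star_mul, star_mul, hps, hqs] at this
  obtain ⟨r, hU, hr, hc, -, -⟩ := exists_unitary_mul_near (z := z) (by linarith) (by linarith)
  refine ⟨z * r, hU, ?_, ?_⟩
  · have h1 : Commute r p := hc p (by
      change star z * z * p = p * (star z * z)
      rw [mul_assoc, hzp, ← mul_assoc, ← hszp, mul_assoc])
    have h2 : z * r * p = q * (z * r) := by rw [mul_assoc, h1.eq, ← mul_assoc, hzp, mul_assoc]
    rw [h2, mul_assoc, (Unitary.mem_iff.mp hU).2, mul_one]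
  · have := norm_add_le (z * r - z) (z - 1)
    rw [sub_add_sub_cancel] at this
    linarith

end Projections

/-! ### Paths of unitaries with finite spectrum -/

section Path

variable {D : Type*} [CStarAlgebra D]

/-- The element is a root of a monic polynomial, and the spectrum lies among the roots. Finiteness
lets discontinuous functions (`arg`, indicators) enter the functional calculus. -/
theorem spectrum_finite_of_mem_finiteDimensional {S : StarSubalgebra ℂ D}
    [FiniteDimensional ℂ S] {a : D} (ha : a ∈ S) : (spectrum ℂ a).Finite := by
  nontriviality D
  have hint : IsIntegral ℂ a := by
    have := (IsIntegral.of_finite ℂ (⟨a, ha⟩ : S)).map S.subtype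
    simpa using this
  obtain ⟨P, hP, hP0⟩ := hint
  refine (P.roots.toFinset.finite_toSet).subset fun t ht => ?_
  have := spectrum.subset_polynomial_aeval a P ⟨t, ht, rfl⟩
  rw [Polynomial.aeval_def, hP0, spectrum.zero_eq] at this
  simpa [hP.ne_zero] using this

open Complex in
/-- A unitary with finite spectrum is joined to `1` by a `π`-Lipschitz path. -/
theorem exists_unitary_path {u : D} (hu : u ∈ unitary D) (hfin : (spectrum ℂ u).Finite) :
    ∃ h : ℝ → D, (∀ t, h t ∈ unitary D) ∧ h 0 = 1 ∧ h 1 = u ∧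
      (∀ s t, ‖h s - h t‖ ≤ Real.pi * |s - t|) ∧
      (∀ c t, Commute u c → Commute (star u) c → Commute (h t) c) ∧
      (∀ (χ : D →⋆ₐ[ℂ] ℂ) t, χ u = 1 → χ (h t) = 1) := by
  have hnorm : IsStarNormal u := (isStarNormal_of_mem_unitary hu)
  have hsp : ∀ z ∈ spectrum ℂ u, ‖z‖ = 1 := fun z hz => by
    simpa using spectrum.subset_circle_of_unitary hu hz
  have hc : ∀ f : ℂ → ℂ, ContinuousOn f (spectrum ℂ u) := fun f => hfin.continuousOn f
  -- The path is `exp(i t arg u)`. The branch cut is harmless on a finite spectrum, `|arg| ≤ π`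
  -- gives the Lipschitz constant, and `arg 1 = 0` keeps the value of `χ` equal to `1`.
  refine ⟨fun t => cfc (fun z : ℂ => exp (I * ((t * arg z : ℝ) : ℂ))) u, fun t => ?_, ?_, ?_,
    fun s t => ?_, fun c t h1 h2 => h1.cfc h2 _, fun χ t hχ => ?_⟩
  · rw [cfc_unitary_iff _ _ hnorm (hc _)]
    intro z _
    rw [RCLike.star_def, ← normSq_eq_conj_mul_self, normSq_eq_norm_sq, mul_comm I,
      norm_exp_ofReal_mul_I]
    simp
  · simp [cfc_const_one ℂ u]
  · nth_rewrite 2 [← cfc_id' ℂ u]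
    refine cfc_congr fun z hz => ?_
    have := norm_mul_exp_arg_mul_I z
    rw [hsp z hz, ofReal_one, one_mul] at this
    simp only [one_mul]
    rw [mul_comm, this]
  · rw [← cfc_sub _ _ u (hc _) (hc _)]
    refine norm_cfc_le (by positivity) fun z hz => ?_
    have : exp (I * ((s * arg z : ℝ) : ℂ)) - exp (I * ((t * arg z : ℝ) : ℂ)) =
        exp (((t * arg z : ℝ) : ℂ) * I) * (exp (I * (((s - t) * arg z : ℝ) : ℂ)) - 1) := by
      rw [mul_sub, ← exp_add, mul_one, mul_comm I, mul_comm I, mul_comm I, ← add_mul]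
      congr 3
      push_cast; ring
    rw [this, norm_mul, norm_exp_ofReal_mul_I, one_mul]
    refine (Real.norm_exp_I_mul_ofReal_sub_one_le).trans ?_
    rw [Real.norm_eq_abs, abs_mul, mul_comm]
    gcongr
    exact abs_arg_le_pi z
  · have hχc := continuous_starAlgHom_complex χ
    rw [StarAlgHomClass.map_cfc (S := ℂ) (q := IsStarNormal) χ _ u (hc _) hχc hnorm
      inferInstance, hχ, ← map_one (algebraMap ℂ ℂ), cfc_algebraMap]
    simp

end Path

/-! ### Averaging over a compact unitary group -/

section Average

open MeasureTheory

variable {D : Type*} [CStarAlgebra D]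

/-- Averaging over the unitary group of a finite-dimensional subalgebra. -/
theorem exists_average_map [Nontrivial D] (S : StarSubalgebra ℂ D) [FiniteDimensional ℂ S] :
    ∃ E : D → D, (∀ x, ∀ s ∈ S, Commute s (E x)) ∧
      (∀ T : StarSubalgebra ℂ D, IsClosed (T : Set D) → S ≤ T → ∀ x ∈ T, E x ∈ T) ∧
      (∀ (χ : D →⋆ₐ[ℂ] ℂ) x, χ (E x) = χ x) ∧
      (∀ x δ, (∀ u ∈ unitary D, u ∈ S → ‖u * x - x * u‖ ≤ δ) → ‖E x - x‖ ≤ δ) := by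
  have hcl : IsClosed (S : Set D) := Submodule.closed_of_finiteDimensional S.toSubmodule
  let : CStarAlgebra S := StarSubalgebra.cstarAlgebra S (h_closed := hcl)
  have hproper : ProperSpace S := FiniteDimensional.proper ℂ S
  have hK : IsCompact (unitary S : Set S) := by
    refine Metric.isCompact_of_isClosed_isBounded ?_ ?_
    · exact isClosed_unitary
    · refine (Metric.isBounded_closedBall (x := (0 : S)) (r := 1)).subset fun u hu => ?_
      rw [mem_closedBall_zero_iff]
      exact (CStarRing.norm_of_mem_unitary hu).le
  have : CompactSpace (unitary S) := isCompact_iff_compactSpace.mp hK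
  let : MeasurableSpace (unitary S) := borel _
  have : BorelSpace (unitary S) := ⟨rfl⟩
  let K : TopologicalSpace.PositiveCompacts (unitary S) := ⊤
  let μ : Measure (unitary S) := Measure.haarMeasure K
  have : IsProbabilityMeasure μ := ⟨by
    simpa [K] using Measure.haarMeasure_self (K₀ := K)⟩
  let c : unitary S → D := fun g => ((g : S) : D)
  have hcc : Continuous c := continuous_subtype_val.comp continuous_subtype_val
  have hcu : ∀ g, c g ∈ unitary D := fun g => by
    have := g.2
    rw [Unitary.mem_iff] at this ⊢
    exact ⟨congrArg Subtype.val this.1, congrArg Subtype.val this.2⟩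
  have hcS : ∀ g, c g ∈ S := fun g => (g : S).2
  have hint : ∀ f : unitary S → D, Continuous f → Integrable f μ := fun f hf =>
    hf.integrable_of_hasCompactSupport (HasCompactSupport.of_compactSpace f)
  have hf : ∀ x : D, Continuous fun g => c g * x * star (c g) := fun x => by fun_prop
  refine ⟨fun x => ∫ g, c g * x * star (c g) ∂μ, fun x s hs => ?_, fun T hT hST x hx => ?_,
    fun χ x => ?_, fun x δ h => ?_⟩
  · set y := ∫ g, c g * x * star (c g) ∂μ with hy
    have key : ∀ g : unitary S, Commute (c g) y := fun g => by
      have h1 : c g * y * star (c g) = y := by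
        have h2 : c g * y * star (c g) = ∫ k, c (g * k) * x * star (c (g * k)) ∂μ := by
          let L : D →L[ℂ] D := (ContinuousLinearMap.mul ℂ D (c g)).comp
            ((ContinuousLinearMap.mul ℂ D).flip (star (c g)))
          have := L.integral_comp_comm (hint _ (hf x))
          simp only [L, ContinuousLinearMap.comp_apply, ContinuousLinearMap.mul_apply',
            ContinuousLinearMap.flip_apply] at this
          rw [mul_assoc, hy, ← this]
          refine integral_congr_ae (Filter.Eventually.of_forall fun k => ?_)
          simp [c, mul_assoc]
        rw [h2]
        exact integral_mul_left_eq_self (μ := μ) (fun k => c k * x * star (c k)) g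
      have h3 : c g * y = c g * y * star (c g) * c g := by
        rw [mul_assoc _ (star (c g)), (Unitary.mem_iff.mp (hcu g)).1, mul_one]
      change c g * y = y * c g
      rw [h3, h1]
    -- Invariance of Haar measure gives commutation with unitaries only; these span the C⋆-algebra
    -- `S`.
    have hspan : (⟨s, hs⟩ : S) ∈ Submodule.span ℂ (unitary S : Set S) := by
      rw [CStarAlgebra.span_unitary]; trivial
    have : ∀ t ∈ Submodule.span ℂ (unitary S : Set S), Commute (t : D) y := fun t ht => by
      induction ht using Submodule.span_induction with
      | mem t ht => exact key ⟨t, ht⟩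
      | zero => simp
      | add a b _ _ ha hb => simpa using ha.add_left hb
      | smul r a _ ha => simpa using ha.smul_left r
    exact this _ hspan
  · have hconv : Convex ℝ (T : Set D) := (T.toSubmodule.restrictScalars ℝ).convex
    refine hconv.integral_mem hT (Filter.Eventually.of_forall fun g => ?_) (hint _ (hf x))
    have := hST (hcS g)
    exact mul_mem (mul_mem this hx) (star_mem this)
  · have hχc := continuous_starAlgHom_complex χ
    let L : D →L[ℂ] ℂ := ⟨χ.toAlgHom.toLinearMap, hχc⟩
    have h1 := L.integral_comp_comm (hint _ (hf x))
    have h2 : ∀ g, L (c g * x * star (c g)) = χ x := fun g => by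
      change χ (c g * x * star (c g)) = χ x
      rw [map_mul, map_mul, mul_right_comm, ← map_mul, (Unitary.mem_iff.mp (hcu g)).2, map_one,
        one_mul]
    simp only [h2] at h1
    change χ _ = χ x
    exact h1.symm.trans (by simp)
  · have h1 : (∫ g, c g * x * star (c g) ∂μ) - x = ∫ g, (c g * x * star (c g) - x) ∂μ := by
      rw [integral_sub (hint _ (hf x)) (integrable_const x)]; simp
    rw [h1]
    have h2 : ∀ g, ‖c g * x * star (c g) - x‖ ≤ δ := fun g => by
      have h3 : c g * x * star (c g) - x = (c g * x - x * c g) * star (c g) := by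
        rw [sub_mul, mul_assoc x, (Unitary.mem_iff.mp (hcu g)).2, mul_one]
      rw [h3]
      refine (norm_mul_le _ _).trans ?_
      rw [norm_star, CStarRing.norm_of_mem_unitary (hcu g), mul_one]
      exact h _ (hcu g) (hcS g)
    simpa using norm_integral_le_of_norm_le_const (μ := μ) (Filter.Eventually.of_forall h2)

end Average

/-! ### Perturbation into commutants and almost commuting paths in `A + ℂ1` -/

section Unitization

variable {A : Type*} [NonUnitalCStarAlgebra A]

/-- The character of the unitization that vanishes on the algebra. -/
def unitizationCharacter (A : Type*) [NonUnitalCStarAlgebra A] : Unitization ℂ A →⋆ₐ[ℂ] ℂ :=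
  { Unitization.fstHom ℂ A with map_star' := fun _ => rfl }

theorem unitizationCharacter_apply (x : Unitization ℂ A) : unitizationCharacter A x = x.fst := rfl

theorem Unitization.norm_fst_le' (x : Unitization ℂ A) : ‖x.fst‖ ≤ ‖x‖ :=
  NonUnitalStarAlgHom.norm_apply_le (unitizationCharacter A) x

theorem Unitization.norm_snd_le_two_mul (x : Unitization ℂ A) : ‖x.snd‖ ≤ 2 * ‖x‖ := by
  have h : (x.snd : Unitization ℂ A) = x - algebraMap ℂ _ x.fst := by
    refine eq_sub_of_add_eq (Unitization.ext ?_ ?_) <;> simp [Unitization.algebraMap_eq_inl]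
  rw [← Unitization.norm_inr (𝕜 := ℂ), h]
  refine (norm_sub_le _ _).trans ?_
  rw [norm_algebraMap']
  linarith [Unitization.norm_fst_le' x]

theorem eq_inr_snd_add_one {x : Unitization ℂ A} (hx : x.fst = 1) :
    x = (x.snd : Unitization ℂ A) + 1 := by
  refine Unitization.ext ?_ ?_ <;> simp [hx]

/-- The subalgebra `B + ℂ1` of the unitization. -/
def unitizationSubalgebra (B : NonUnitalStarSubalgebra ℂ A) :
    StarSubalgebra ℂ (Unitization ℂ A) where
  carrier := {x | x.snd ∈ B}
  mul_mem' {x y} hx hy := by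
    simp only [Set.mem_ofPred_eq, Unitization.snd_mul]
    exact add_mem (add_mem (SMulMemClass.smul_mem _ hy) (SMulMemClass.smul_mem _ hx))
      (mul_mem hx hy)
  add_mem' {x y} hx hy := by
    simp only [Set.mem_ofPred_eq, Unitization.snd_add]
    exact add_mem hx hy
  algebraMap_mem' r := by simp [Unitization.algebraMap_eq_inl]
  star_mem' {x} hx := by
    simp only [Set.mem_ofPred_eq, Unitization.snd_star] at hx ⊢
    exact star_mem hx

theorem mem_unitizationSubalgebra {B : NonUnitalStarSubalgebra ℂ A} {x : Unitization ℂ A} :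
    x ∈ unitizationSubalgebra B ↔ x.snd ∈ B := Iff.rfl

theorem unitizationSubalgebra_mono {B C : NonUnitalStarSubalgebra ℂ A} (h : B ≤ C) :
    unitizationSubalgebra B ≤ unitizationSubalgebra C := fun _ hx => h hx

instance finiteDimensional_unitizationSubalgebra (B : NonUnitalStarSubalgebra ℂ A)
    [FiniteDimensional ℂ B] : FiniteDimensional ℂ (unitizationSubalgebra B) := by
  let f : (unitizationSubalgebra B) →ₗ[ℂ] ℂ × B :=
    { toFun := fun x => (x.1.fst, ⟨x.1.snd, x.2⟩)
      map_add' := fun _ _ => rfl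
      map_smul' := fun _ _ => rfl }
  refine FiniteDimensional.of_injective f fun x y h => ?_
  exact Subtype.ext (Unitization.ext (congrArg (fun z : ℂ × B => z.1) h)
    (congrArg (fun z : ℂ × B => (z.2 : A)) h))

theorem isClosed_unitizationSubalgebra (B : NonUnitalStarSubalgebra ℂ A)
    [FiniteDimensional ℂ B] : IsClosed (unitizationSubalgebra B : Set (Unitization ℂ A)) :=
  have : FiniteDimensional ℂ (unitizationSubalgebra B).toSubmodule :=
    finiteDimensional_unitizationSubalgebra B
  Submodule.closed_of_finiteDimensional (unitizationSubalgebra B).toSubmodule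

/-- Commutators with the unitary group of `B + ℂ1` are controlled by finitely many of them. -/
theorem exists_finset_commutator_bound (B : NonUnitalStarSubalgebra ℂ A) [FiniteDimensional ℂ B] :
    ∃ (G : Finset A) (C : ℝ), 0 < C ∧ ∀ (x : Unitization ℂ A) (δ : ℝ), 0 ≤ δ →
      (∀ g ∈ G, ‖(g : Unitization ℂ A) * x - x * g‖ ≤ δ) →
      ∀ u ∈ unitary (Unitization ℂ A), u ∈ unitizationSubalgebra B → ‖u * x - x * u‖ ≤ C * δ := by
  classical
  let b := Module.finBasis ℂ B.toSubmodule
  obtain ⟨C, hC, h⟩ := b.exists_opNorm_le (F := Unitization ℂ A)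
  -- `C` bounds a linear map on `B` by its values on a basis. Scalars drop out of the commutator,
  -- and the part in `A` of a unitary has norm at most `2`.
  refine ⟨Finset.univ.image fun i => (b i : A), 2 * C, by positivity, fun x δ hδ hx u hu huB => ?_⟩
  let ι : B.toSubmodule →L[ℂ] Unitization ℂ A :=
    ((LinearMap.mkContinuous (Unitization.inrHom ℂ ℂ A : A →ₗ[ℂ] Unitization ℂ A) 1
      fun a => by simp [Unitization.norm_inr])).comp B.toSubmodule.subtypeL
  have hι : ∀ a, ι a = ((a : A) : Unitization ℂ A) := fun a => rfl
  let L : B.toSubmodule →L[ℂ] Unitization ℂ A :=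
    (((ContinuousLinearMap.mul ℂ _).flip x) - (ContinuousLinearMap.mul ℂ _ x)).comp ι
  have hL : ∀ a, L a = (a : A) * x - x * (a : A) := fun a => by
    simp [L, hι]
  have hn : ‖L‖ ≤ C * δ := h hδ fun i => by
    rw [hL]; exact hx _ (by simp)
  have h1 : u * x - x * u = L ⟨u.snd, huB⟩ := by
    rw [hL]
    have hu' : u = algebraMap ℂ _ u.fst + (u.snd : Unitization ℂ A) := by
      refine Unitization.ext ?_ ?_ <;> simp [Unitization.algebraMap_eq_inl]
    nth_rewrite 1 [hu']
    nth_rewrite 3 [hu']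
    rw [add_mul, mul_add, Algebra.commutes]
    abel
  rw [h1]
  refine (L.le_opNorm _).trans ?_
  have h2 : ‖(⟨u.snd, huB⟩ : B.toSubmodule)‖ ≤ 2 := by
    have := Unitization.norm_snd_le_two_mul u
    rw [CStarRing.norm_of_mem_unitary hu, mul_one] at this
    exact this
  calc ‖L‖ * _ ≤ (C * δ) * 2 := by gcongr
    _ = _ := by ring

theorem norm_star_mul_self_sub_le {D : Type*} [CStarAlgebra D] {y V : D} :
    ‖star y * y - star V * V‖ ≤ ‖y - V‖ * (‖y‖ + ‖V‖) := by
  have : star y * y - star V * V = star (y - V) * y + star V * (y - V) := by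
    rw [star_sub]; noncomm_ring
  rw [this]
  refine (norm_add_le _ _).trans ?_
  have h1 := norm_mul_le (star (y - V)) y
  have h2 := norm_mul_le (star V) (y - V)
  rw [norm_star] at h1 h2
  linarith

theorem norm_mul_star_self_sub_le {D : Type*} [CStarAlgebra D] {y V : D} :
    ‖y * star y - V * star V‖ ≤ ‖y - V‖ * (‖y‖ + ‖V‖) := by
  have := norm_star_mul_self_sub_le (y := star y) (V := star V)
  rwa [star_star, star_star, ← star_sub, norm_star, norm_star, norm_star] at this

theorem norm_le_two_of_norm_star_mul_self_sub_one_le {D : Type*} [CStarAlgebra D] [Nontrivial D]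
    {V : D} (h : ‖star V * V - 1‖ ≤ 1) : ‖V‖ ≤ 2 := by
  have h3 : ‖V‖ * ‖V‖ = ‖star V * V‖ := by rw [CStarRing.norm_star_mul_self]
  have h4 := norm_add_le (star V * V - 1) 1
  rw [CStarRing.norm_one, sub_add_cancel] at h4
  nlinarith [norm_nonneg V]

/-- An almost unitary element of `1 + A` almost commuting with a finite-dimensional subalgebra is
close to a unitary of `1 + A` in the commutant. -/
theorem exists_unitary_in_commutant_near (B : NonUnitalStarSubalgebra ℂ A)
    [FiniteDimensional ℂ B] {ε : ℝ} (hε : 0 < ε) :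
    ∃ (G : Finset A) (δ : ℝ), 0 < δ ∧ ∀ V : Unitization ℂ A, V.fst = 1 →
      ‖star V * V - 1‖ ≤ δ → ‖V * star V - 1‖ ≤ δ →
      (∀ g ∈ G, ‖(g : Unitization ℂ A) * V - V * g‖ ≤ δ) →
      ∃ W ∈ unitary (Unitization ℂ A), W.fst = 1 ∧
        (∀ b ∈ B, Commute (b : Unitization ℂ A) W) ∧ ‖W - V‖ ≤ ε ∧
        ∀ T : NonUnitalStarSubalgebra ℂ A, FiniteDimensional ℂ T → B ≤ T →
          V ∈ unitizationSubalgebra T → W ∈ unitizationSubalgebra T := by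
  obtain ⟨G, C, hC, hG⟩ := exists_finset_commutator_bound B
  obtain ⟨E, hE1, hE2, hE3, hE4⟩ := exists_average_map (unitizationSubalgebra B)
  -- Averaging moves `V` by at most `C * δ`, which leaves a unitarity defect of at most `5 * C * δ +
  -- δ`. Polar decomposition costs twice that, so the total is `(11 * C + 2) * δ`.
  refine ⟨G, min ε (1 / 2) / (11 * C + 2), by positivity, fun V hV h1 h2 h3 => ?_⟩
  set δ := min ε (1 / 2) / (11 * C + 2) with hδ
  have hδ0 : 0 < δ := by positivity
  have hδC : δ * (11 * C + 2) = min ε (1 / 2) := by rw [hδ]; field_simp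
  have hδε : 11 * (C * δ) + 2 * δ ≤ ε := by
    linarith [min_le_left ε (1 / 2)]
  have hδh : 11 * (C * δ) + 2 * δ ≤ 1 / 2 := by
    linarith [min_le_right ε (1 / 2)]
  have hCδ : 0 < C * δ := by positivity
  have hyV : ‖E V - V‖ ≤ C * δ := hE4 V _ fun u hu huB => hG V δ hδ0.le h3 u hu huB
  set y := E V with hy
  have hy1 : y.fst = 1 := by
    rw [← hV]; exact hE3 (unitizationCharacter A) V
  have hVn : ‖V‖ ≤ 2 := norm_le_two_of_norm_star_mul_self_sub_one_le (by linarith)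
  have hyn : ‖y‖ ≤ 3 := by
    have := norm_add_le (y - V) V
    rw [sub_add_cancel] at this
    linarith
  have hb : ‖y - V‖ * (‖y‖ + ‖V‖) ≤ 5 * (C * δ) := by nlinarith [norm_nonneg (y - V)]
  have hyy : ‖star y * y - 1‖ ≤ 5 * (C * δ) + δ := by
    have := norm_add_le (star y * y - star V * V) (star V * V - 1)
    rw [sub_add_sub_cancel] at this
    linarith [norm_star_mul_self_sub_le (y := y) (V := V)]
  have hyy' : ‖y * star y - 1‖ ≤ 5 * (C * δ) + δ := by
    have := norm_add_le (y * star y - V * star V) (V * star V - 1)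
    rw [sub_add_sub_cancel] at this
    linarith [norm_mul_star_self_sub_le (y := y) (V := V)]
  obtain ⟨r, hu, hr, hrc, hrS, hrχ⟩ := exists_unitary_mul_near (z := y) (by linarith) (by linarith)
  have hyS : ∀ b ∈ B, Commute (b : Unitization ℂ A) y := fun b hb => hE1 V _ (by
    simpa [mem_unitizationSubalgebra] using hb)
  refine ⟨y * r, hu, ?_, fun b hb => ?_, ?_, fun T hT hBT hVT => ?_⟩
  · have := hrχ (unitizationCharacter A) hy1
    rw [unitizationCharacter_apply] at this
    simp [this, hy1]
  · refine (hyS b hb).mul_right (hrc _ ?_).symm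
    have h4 := (hyS _ (star_mem hb)).star_star
    rw [← Unitization.inr_star, star_star] at h4
    exact h4.symm.mul_left (hyS b hb).symm
  · have := norm_add_le (y * r - y) (y - V)
    rw [sub_add_sub_cancel] at this
    linarith
  · have hcl := isClosed_unitizationSubalgebra T
    have hyT := hE2 _ hcl (unitizationSubalgebra_mono hBT) V hVT
    exact mul_mem hyT (hrS _ hcl hyT)

/-- Finitely many elements of an AF algebra are close to one of the subalgebras. -/
theorem exists_forall_close {B : ℕ → NonUnitalStarSubalgebra ℂ A} (hmono : Monotone B)
    (hdense : Dense (⋃ n, (B n : Set A))) (G : Finset A) (n₀ : ℕ) {η : ℝ} (hη : 0 < η) :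
    ∃ n, n₀ ≤ n ∧ ∀ g ∈ G, ∃ b ∈ B n, ‖g - b‖ ≤ η := by
  classical
  induction G using Finset.induction_on with
  | empty => exact ⟨n₀, le_rfl, by simp⟩
  | insert a G _ ih =>
    obtain ⟨n, hn, h⟩ := ih
    obtain ⟨b, hb, hab⟩ := hdense.exists_dist_lt a hη
    obtain ⟨m, hm⟩ := Set.mem_iUnion.mp hb
    refine ⟨max n m, hn.trans (le_max_left _ _), fun g hg => ?_⟩
    rcases Finset.mem_insert.mp hg with rfl | hg
    · exact ⟨b, hmono (le_max_right n m) hm, by rw [← dist_eq_norm]; exact hab.le⟩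
    · obtain ⟨c, hc, hgc⟩ := h g hg
      exact ⟨c, hmono (le_max_left n m) hc, hgc⟩

theorem norm_commutator_le {D : Type*} [NonUnitalNormedRing D] (a b : D) :
    ‖a * b - b * a‖ ≤ 2 * ‖a‖ * ‖b‖ := by
  refine (norm_sub_le _ _).trans ?_
  linarith [norm_mul_le a b, norm_mul_le b a]

theorem norm_commutator_le_add {D : Type*} [NonUnitalNormedRing D] (a b c : D) :
    ‖a * b - b * a‖ ≤ ‖a * c - c * a‖ + 2 * ‖a‖ * ‖b - c‖ := by
  have : a * b - b * a = (a * c - c * a) + (a * (b - c) - (b - c) * a) := by noncomm_ring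
  rw [this]
  exact (norm_add_le _ _).trans (by gcongr; exact norm_commutator_le _ _)

theorem norm_inr_commutator_le_of_close {a b : A} {W : Unitization ℂ A}
    (hW : W ∈ unitary (Unitization ℂ A)) (hb : Commute (b : Unitization ℂ A) W) :
    ‖(a : Unitization ℂ A) * W - W * a‖ ≤ 2 * ‖a - b‖ := by
  rw [norm_sub_rev]
  have := norm_commutator_le_add W (a : Unitization ℂ A) b
  rw [hb.eq, sub_self, norm_zero, zero_add, CStarRing.norm_of_mem_unitary hW, mul_one,
    ← Unitization.inr_sub, Unitization.norm_inr] at this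
  exact this

/-- In an AF algebra, a unitary of `1 + A` that almost commutes with enough elements is close to
the end of a path of bounded speed through unitaries almost commuting with given elements. -/
theorem exists_unitary_path_almost_commuting (hA : IsAFAlgebra A) (G : Finset A) {ε : ℝ}
    (hε : 0 < ε) :
    ∃ (G' : Finset A) (δ : ℝ), 0 < δ ∧ ∀ W ∈ unitary (Unitization ℂ A), W.fst = 1 →
      (∀ g ∈ G', ‖(g : Unitization ℂ A) * W - W * g‖ ≤ δ) →
      ∃ h : ℝ → Unitization ℂ A, (∀ t, h t ∈ unitary (Unitization ℂ A)) ∧ (∀ t, (h t).fst = 1) ∧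
        h 0 = 1 ∧ ‖h 1 - W‖ ≤ ε ∧ (∀ s t, ‖h s - h t‖ ≤ Real.pi * |s - t|) ∧
        ∀ g ∈ G, ∀ t, ‖(g : Unitization ℂ A) * h t - h t * g‖ ≤ ε := by
  obtain ⟨B, hmono, hfd, hdense⟩ := hA
  obtain ⟨n, -, hn⟩ := exists_forall_close hmono hdense G 0 (half_pos hε)
  obtain ⟨G', δ, hδ, hG'⟩ := exists_unitary_in_commutant_near (B n) (half_pos hε)
  refine ⟨G', δ / 2, half_pos hδ, fun W hW hW1 hWG => ?_⟩
  set M := ∑ g ∈ G', ‖g‖ with hM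
  have hM0 : 0 ≤ M := Finset.sum_nonneg fun _ _ => norm_nonneg _
  have hgM : ∀ g ∈ G', ‖g‖ ≤ M := fun g hg =>
    Finset.single_le_sum (f := fun g : A => ‖g‖) (fun _ _ => norm_nonneg _) hg
  obtain ⟨η, hη, hη1, hηδ, hηM, hηε⟩ : ∃ η > 0, η ≤ 1 ∧ 3 * η ≤ δ ∧ 2 * M * η ≤ δ / 2 ∧
      η ≤ ε / 2 := by
    refine ⟨min (min 1 (ε / 2)) (min (δ / 3) (δ / (4 * (M + 1)))), by positivity,
      (min_le_left _ _).trans (min_le_left _ _), ?_, ?_,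
      (min_le_left _ _).trans (min_le_right _ _)⟩
    · have := (min_le_right (min 1 (ε / 2)) _).trans (min_le_left (δ / 3) (δ / (4 * (M + 1))))
      linarith
    · have := (min_le_right (min 1 (ε / 2)) _).trans (min_le_right (δ / 3) (δ / (4 * (M + 1))))
      refine (mul_le_mul_of_nonneg_left this (by positivity)).trans ?_
      rw [← mul_div_assoc, div_le_div_iff₀ (by positivity) (by positivity)]
      nlinarith
  -- Taking `m ≥ n` gives `B n ≤ B m`, so the perturbation into the commutant of `B n` stays in `B m
  -- + ℂ1` and has finite spectrum. The path, a function of this unitary, then commutes exactly with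
  -- `B n`.
  obtain ⟨m, hnm, hm⟩ := exists_forall_close hmono hdense {W.snd} n hη
  obtain ⟨w, hw, hwW⟩ := hm W.snd (by simp)
  set V : Unitization ℂ A := (w : Unitization ℂ A) + 1 with hV
  have hVW : ‖V - W‖ ≤ η := by
    rw [eq_inr_snd_add_one hW1, hV, add_sub_add_right_eq_sub, ← Unitization.inr_sub,
      Unitization.norm_inr, norm_sub_rev]
    exact hwW
  have hWn : ‖W‖ = 1 := CStarRing.norm_of_mem_unitary hW
  have hVn : ‖V‖ ≤ 2 := by
    have := norm_add_le (V - W) W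
    rw [sub_add_cancel] at this
    linarith
  have hb : ‖V - W‖ * (‖V‖ + ‖W‖) ≤ δ := by nlinarith [norm_nonneg (V - W)]
  obtain ⟨u, hu, hu1, huB, huV, huS⟩ := hG' V (by simp [hV])
    (by
      have := norm_star_mul_self_sub_le (y := V) (V := W)
      rw [(Unitary.mem_iff.mp hW).1] at this
      exact this.trans hb)
    (by
      have := norm_mul_star_self_sub_le (y := V) (V := W)
      rw [(Unitary.mem_iff.mp hW).2] at this
      exact this.trans hb)
    (fun g hg => by
      refine (norm_commutator_le_add _ _ W).trans ?_
      have h1 := hWG g hg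
      have h2 : 2 * ‖(g : Unitization ℂ A)‖ * ‖V - W‖ ≤ 2 * M * η := by
        rw [Unitization.norm_inr]
        gcongr
        exact hgM g hg
      linarith)
  have := hfd m
  have huS' := huS (B m) (hfd m) (hmono hnm)
    (by rw [mem_unitizationSubalgebra]; simpa [hV] using hw)
  obtain ⟨h, hh1, hh2, hh3, hh4, hh5, hh6⟩ :=
    exists_unitary_path hu (spectrum_finite_of_mem_finiteDimensional huS')
  refine ⟨h, hh1, fun t => hh6 (unitizationCharacter A) t hu1, hh2, ?_, hh4, fun g hg t => ?_⟩
  · rw [hh3]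
    have := norm_add_le (u - V) (V - W)
    rw [sub_add_sub_cancel] at this
    linarith
  · obtain ⟨b, hb, hgb⟩ := hn g hg
    have hc : Commute (b : Unitization ℂ A) (h t) := by
      refine (hh5 _ t (huB b hb).symm ?_).symm
      have h4 := (huB _ (star_mem hb)).star_star
      rw [← Unitization.inr_star, star_star] at h4
      exact h4.symm
    refine (norm_inr_commutator_le_of_close (hh1 t) hc).trans ?_
    linarith

end Unitization

/-! ### Orthogonality of projections summing to a projection -/

section SumsOfProjections

variable {D : Type*} [CStarAlgebra D]

theorem eq_zero_of_sum_mul_star_eq_zero {ι : Type*} {s : Finset ι} {x : ι → D}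
    (h : ∑ i ∈ s, x i * star (x i) = 0) {i : ι} (hi : i ∈ s) : x i = 0 := by
  let : PartialOrder D := CStarAlgebra.spectralOrder D
  have : StarOrderedRing D := CStarAlgebra.spectralOrderedRing D
  rw [Finset.sum_eq_zero_iff_of_nonneg fun i _ => mul_star_self_nonneg (x i)] at h
  exact CStarRing.mul_star_self_eq_zero_iff _ |>.mp (h i hi)

/-- Projections whose sum is a projection are pairwise orthogonal. -/
theorem mul_eq_zero_of_isStarProjection_sum {ι : Type*} [Fintype ι] {p : ι → D}
    (hp : ∀ i, IsStarProjection (p i)) (hE : IsStarProjection (∑ i, p i)) {i j : ι}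
    (hij : i ≠ j) : p i * p j = 0 := by
  classical
  have hpp := fun i => (hp i).isIdempotentElem.eq
  have hps := fun i => (hp i).isSelfAdjoint.star_eq
  set E := ∑ i, p i with hEdef
  -- The positive elements `(1 - E) p_i (1 - E)` sum to `(1 - E) E (1 - E) = 0`. Below, `p_i = ∑_j
  -- p_i p_j p_i` is treated likewise.
  have h1 : ∀ i, (1 - E) * p i = 0 := fun i => by
    refine eq_zero_of_sum_mul_star_eq_zero (s := Finset.univ) (x := fun i => (1 - E) * p i) ?_
      (Finset.mem_univ i)
    have : ∀ i, (1 - E) * p i * star ((1 - E) * p i) = (1 - E) * p i * (1 - E) := fun i => by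
      rw [star_mul, hps, hE.one_sub.isSelfAdjoint.star_eq, mul_assoc, ← mul_assoc (p i), hpp,
        mul_assoc]
    simp only [this]
    rw [← Finset.sum_mul, ← Finset.mul_sum, ← hEdef, hE.one_sub_mul_self, zero_mul]
  have h2 : E * p i = p i := by
    have := h1 i
    rw [sub_mul, one_mul, sub_eq_zero] at this
    exact this.symm
  refine eq_zero_of_sum_mul_star_eq_zero (s := Finset.univ.erase i) (x := fun j => p i * p j) ?_
    (Finset.mem_erase.mpr ⟨hij.symm, Finset.mem_univ j⟩)
  have : ∀ j, p i * p j * star (p i * p j) = p i * p j * p i := fun j => by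
    rw [star_mul, hps, hps, mul_assoc, ← mul_assoc (p j), hpp, mul_assoc]
  simp only [this]
  have h3 : ∑ j, p i * p j * p i = p i := by
    rw [← Finset.sum_mul, ← Finset.mul_sum, ← hEdef, mul_assoc, h2, hpp]
  rw [← Finset.add_sum_erase _ _ (Finset.mem_univ i), hpp, hpp] at h3
  simpa using h3

end SumsOfProjections

/-! ### Units and projections in finite-dimensional subalgebras -/

section FiniteDimensionalSubalgebras

variable {A : Type*} [NonUnitalCStarAlgebra A]

theorem spectrum_real_finite {D : Type*} [CStarAlgebra D] {a : D} (h : (spectrum ℂ a).Finite) :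
    (spectrum ℝ a).Finite := by
  have : spectrum ℝ a = (algebraMap ℝ ℂ) ⁻¹' spectrum ℂ a :=
    (spectrum.preimage_algebraMap ℂ).symm
  rw [this]
  exact h.preimage (Complex.ofReal_injective.injOn)

/-- Spectral projections of self-adjoint elements of finite-dimensional subalgebras. -/
theorem exists_spectral_projection (T : NonUnitalStarSubalgebra ℂ A) [FiniteDimensional ℂ T]
    {a : A} (ha : a ∈ T) (hsa : IsSelfAdjoint a) {φ : ℝ → ℝ} (hφ0 : φ 0 = 0)
    (hφ : ∀ t, φ t = 0 ∨ φ t = 1) :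
    (spectrum ℝ (a : Unitization ℂ A)).Finite ∧ ∃ e ∈ T, IsStarProjection e ∧
      (e : Unitization ℂ A) = cfc φ (a : Unitization ℂ A) := by
  have haT : (a : Unitization ℂ A) ∈ unitizationSubalgebra T := by
    simpa [mem_unitizationSubalgebra] using ha
  have hfin := spectrum_real_finite (spectrum_finite_of_mem_finiteDimensional haT)
  have hsa' : IsSelfAdjoint (a : Unitization ℂ A) := by
    rw [IsSelfAdjoint, ← Unitization.inr_star, hsa.star_eq]
  set c := cfc φ (a : Unitization ℂ A) with hc
  have hcont : ContinuousOn φ (spectrum ℝ (a : Unitization ℂ A)) := hfin.continuousOn φ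
  have hcs : IsSelfAdjoint c := cfc_predicate _ _
  have hcc : c * c = c := by
    rw [hc, ← cfc_mul _ _ _ hcont hcont]
    refine cfc_congr fun t _ => ?_
    rcases hφ t with h | h <;> simp [h]
  have hcT : c ∈ unitizationSubalgebra T :=
    cfc_mem (hs := isClosed_unitizationSubalgebra T) _ haT
  -- The condition `φ 0 = 0` keeps the spectral projection in `A` rather than merely in `A + ℂ1`.
  have hfst : c.fst = 0 := by
    have hχc := continuous_starAlgHom_complex (unitizationCharacter A)
    have h0 : unitizationCharacter A (a : Unitization ℂ A) = 0 := by
      simp [unitizationCharacter_apply]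
    have := StarAlgHomClass.map_cfc (S := ℂ) (q := IsSelfAdjoint) (unitizationCharacter A) φ
      (a : Unitization ℂ A) hcont hχc hsa' (by rw [h0]; exact IsSelfAdjoint.zero _)
    rw [h0, ← map_zero (algebraMap ℝ ℂ), cfc_algebraMap, hφ0, map_zero] at this
    exact this
  have hcsnd : (c.snd : Unitization ℂ A) = c := by
    refine Unitization.ext ?_ ?_ <;> simp [hfst]
  refine ⟨hfin, c.snd, hcT, ⟨?_, ?_⟩, hcsnd⟩
  · apply Unitization.inr_injective (R := ℂ)
    rw [Unitization.inr_mul, hcsnd, hcc]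
  · apply Unitization.inr_injective (R := ℂ)
    rw [Unitization.inr_star, hcsnd, hcs.star_eq]

/-- A finite-dimensional ⋆-subalgebra of a C⋆-algebra has a unit. -/
theorem exists_unit_of_finiteDimensional (T : NonUnitalStarSubalgebra ℂ A)
    [FiniteDimensional ℂ T] :
    ∃ e ∈ T, IsStarProjection e ∧ (∀ b ∈ T, e * b = b) ∧ ∀ b ∈ T, b * e = b := by
  classical
  let v := Module.finBasis ℂ T.toSubmodule
  -- The unit is the support projection `e` of `s`: `(1 - e) s (1 - e) = 0` is a sum of positive
  -- terms, so `1 - e` kills each basis vector.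
  set s : A := ∑ i, (v i : A) * star (v i : A) with hs
  have hsT : s ∈ T := sum_mem fun i _ => mul_mem (v i).2 (star_mem (v i).2)
  have hsa : IsSelfAdjoint s := by
    rw [IsSelfAdjoint, hs, star_sum]
    simp
  obtain ⟨hfin, e, heT, he, hec⟩ := exists_spectral_projection T hsT hsa
    (φ := fun t => if t = 0 then 0 else 1) (by simp) (fun t => by
      by_cases h : t = 0 <;> simp [h])
  have hes : (e : Unitization ℂ A) * s = s := by
    have hsa' : IsSelfAdjoint (s : Unitization ℂ A) := by
      rw [IsSelfAdjoint, ← Unitization.inr_star, hsa.star_eq]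
    rw [hec]
    nth_rewrite 2 [← cfc_id' ℝ (s : Unitization ℂ A)]
    rw [← cfc_mul _ _ _ (hfin.continuousOn _) (by fun_prop)]
    refine (cfc_congr fun t _ => ?_).trans (cfc_id' ℝ (s : Unitization ℂ A))
    by_cases h : t = 0 <;> simp [h]
  have hv : ∀ i, e * (v i : A) = v i := fun i => by
    have h0 : (1 - (e : Unitization ℂ A)) * ((v i : A) : Unitization ℂ A) = 0 := by
      refine eq_zero_of_sum_mul_star_eq_zero (s := Finset.univ)
        (x := fun i => (1 - (e : Unitization ℂ A)) * ((v i : A) : Unitization ℂ A)) ?_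
        (Finset.mem_univ i)
      have h1 : ∑ i, ((v i : A) : Unitization ℂ A) * star ((v i : A) : Unitization ℂ A) = s := by
        have := map_sum (Unitization.inrHom ℂ ℂ A) (fun i => (v i : A) * star (v i : A))
          Finset.univ
        simp only [Unitization.inrHom_apply, Unitization.inr_mul, Unitization.inr_star] at this
        rw [hs, ← this]
      simp only [star_mul, mul_assoc]
      rw [← Finset.mul_sum]
      simp only [← mul_assoc]
      rw [← Finset.sum_mul, h1, ← mul_assoc, sub_mul, hes, one_mul, sub_self, zero_mul]
    rw [sub_mul, one_mul, sub_eq_zero, ← Unitization.inr_mul] at h0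
    exact (Unitization.inr_injective h0).symm
  have hl : ∀ b ∈ T, e * b = b := fun b hb => by
    have hspan : (⟨b, hb⟩ : T.toSubmodule) ∈ Submodule.span ℂ (Set.range v) := by
      rw [v.span_eq]; trivial
    have : ∀ t ∈ Submodule.span ℂ (Set.range v), e * (t : A) = t := fun t ht => by
      induction ht using Submodule.span_induction with
      | mem t ht => obtain ⟨i, rfl⟩ := ht; exact hv i
      | zero => simp
      | add a b _ _ ha hb => simp [mul_add, ha, hb]
      | smul r a _ ha => simp [mul_smul_comm, ha]
    exact this _ hspan
  refine ⟨e, heT, he, hl, fun b hb => ?_⟩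
  have := congrArg star (hl _ (star_mem hb))
  rwa [star_mul, star_star, he.isSelfAdjoint.star_eq] at this

/-- A projection close to a finite-dimensional ⋆-subalgebra is close to a projection in it. -/
theorem exists_projection_near (T : NonUnitalStarSubalgebra ℂ A) [FiniteDimensional ℂ T]
    {p b : A} (hp : IsStarProjection p) (hb : b ∈ T) {η : ℝ} (hη : η ≤ 1) (h : ‖p - b‖ ≤ η) :
    ∃ f ∈ T, IsStarProjection f ∧ ‖f - p‖ ≤ 9 * η := by
  set a : A := (2⁻¹ : ℂ) • (b + star b) with ha
  have haT : a ∈ T := SMulMemClass.smul_mem _ (add_mem hb (star_mem hb))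
  have hsa : IsSelfAdjoint a := by
    rw [IsSelfAdjoint, ha, star_smul, star_add, star_star, add_comm]
    simp
  have hpn : ‖p‖ ≤ 1 := by
    have h : ‖p‖ * ‖p‖ = ‖p‖ := by
      rw [← CStarRing.norm_star_mul_self, hp.isSelfAdjoint.star_eq, hp.isIdempotentElem.eq]
    nlinarith [norm_nonneg p]
  have hap : ‖a - p‖ ≤ η := by
    have h1 : a - p = (2⁻¹ : ℂ) • ((b - p) + star (b - p)) := by
      rw [star_sub, hp.isSelfAdjoint.star_eq, ha, show b - p + (star b - p) =
        (b + star b) - (2 : ℂ) • p by rw [two_smul]; abel, smul_sub _ (b + star b), smul_smul]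
      norm_num
    rw [h1, norm_smul]
    have := norm_add_le (b - p) (star (b - p))
    rw [norm_star, norm_sub_rev b] at this
    rw [show ‖(2⁻¹ : ℂ)‖ = 1 / 2 by norm_num]
    linarith
  have han : ‖a‖ ≤ 2 := by
    have := norm_add_le (a - p) p
    rw [sub_add_cancel] at this
    linarith
  have haa : ‖a * a - a‖ ≤ 4 * η := by
    have h1 : a * a - a = (a - p) * a + p * (a - p) - (a - p) := by
      simp only [sub_mul, mul_sub, hp.isIdempotentElem.eq]; abel
    rw [h1]
    refine (norm_sub_le _ _).trans ?_
    have h2 := norm_add_le ((a - p) * a) (p * (a - p))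
    have h3 := norm_mul_le (a - p) a
    have h4 := norm_mul_le p (a - p)
    nlinarith [norm_nonneg (a - p)]
  obtain ⟨hfin, f, hfT, hf, hfc⟩ := exists_spectral_projection T haT hsa
    (φ := fun t => if 1 / 2 < t then 1 else 0) (by norm_num) (fun t => by
      by_cases h : 1 / 2 < t <;> simp only [h, if_true, if_false, true_or, or_true])
  refine ⟨f, hfT, hf, ?_⟩
  have hsa' : IsSelfAdjoint (a : Unitization ℂ A) := by
    rw [IsSelfAdjoint, ← Unitization.inr_star, hsa.star_eq]
  -- On the spectrum `|t| |t - 1| ≤ 4 * η`, and the factor farther from zero is at least `1/2`.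
  have hfa : ‖f - a‖ ≤ 8 * η := by
    rw [← Unitization.norm_inr (𝕜 := ℂ), Unitization.inr_sub, hfc]
    nth_rewrite 2 [← cfc_id' ℝ (a : Unitization ℂ A)]
    rw [← cfc_sub _ _ _ (hfin.continuousOn _) (by fun_prop)]
    refine norm_cfc_le (by linarith [norm_nonneg (p - b)]) fun t ht => ?_
    have h1 : |t * t - t| ≤ 4 * η := by
      have h2 := norm_apply_le_norm_cfc (fun t : ℝ => t * t - t) (a : Unitization ℂ A) ht
        (by fun_prop)
      rw [cfc_sub _ _ _ (by fun_prop) (by fun_prop), cfc_mul _ _ _ (by fun_prop) (by fun_prop),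
        cfc_id' ℝ (a : Unitization ℂ A), ← Unitization.inr_mul, ← Unitization.inr_sub,
        Unitization.norm_inr] at h2
      exact h2.trans haa
    rw [Real.norm_eq_abs]
    rw [abs_le] at h1
    by_cases h : 1 / 2 < t
    · simp only [h, if_true]
      rw [abs_le]
      constructor <;> by_cases h5 : t ≤ 1 <;> nlinarith
    · simp only [h, if_false]
      rw [abs_le]
      constructor <;> by_cases h5 : 0 ≤ t <;> nlinarith
  have := norm_add_le (f - a) (a - p)
  rw [sub_add_sub_cancel] at this
  linarith

end FiniteDimensionalSubalgebras

/-! ### Approximate Rohlin towers without a unit -/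

section Towers

variable {A : Type*} [NonUnitalCStarAlgebra A]

/-- The cyclic shift on the levels of finitely many towers of heights `K i`. -/
def towerShift {m : ℕ} (K : Fin m → ℕ) : Equiv.Perm (Σ i, Fin (K i)) :=
  Equiv.sigmaCongrRight fun i => finRotate (K i)

theorem towerShift_apply {m : ℕ} (K : Fin m → ℕ) (i : Fin m) (j : Fin (K i)) :
    towerShift K ⟨i, j⟩ = ⟨i, finRotate (K i) j⟩ := rfl

theorem apply_finRotate_of_cyclic {β : Type*} {n : ℕ} (f : ℕ → β) (hf : f n = f 0) (j : Fin n) :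
    f (finRotate n j) = f (j + 1) := by
  obtain _ | n := n
  · exact j.elim0
  · rw [coe_finRotate]
    split_ifs with h
    · rw [h, Fin.val_last, hf]
    · rfl

theorem inr_adOn (U : Unitization ℂ A) (a : A) :
    ((adOn U a : A) : Unitization ℂ A) = U * (a : Unitization ℂ A) * star U := by
  refine Unitization.ext ?_ ?_ <;> simp [adOn]

/-- Enough elements of an AF algebra almost multiply into a corner by a projection `E` that
contains a projection `e` and a unitary perturbation of its image under an automorphism. -/
theorem exists_rohlin_corner (hA : IsAFAlgebra A) (α : A ≃⋆ₐ[ℂ] A) (G : Finset A) {η : ℝ}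
    (hη : 0 < η) (hη1 : η ≤ 1) :
    ∃ E e : A, ∃ U ∈ unitary (Unitization ℂ A), IsStarProjection E ∧ IsStarProjection e ∧
      E * e = e ∧ E * adOn U (α e) = adOn U (α e) ∧ ‖U - 1‖ ≤ η ∧
      IsStarProjection (adOn U (α e)) ∧ ‖adOn U (α e) - α e‖ ≤ η ∧
      ∀ x ∈ G, ‖e * x - x‖ ≤ η ∧ ‖E * x - x‖ ≤ η ∧ ‖x * E - x‖ ≤ η := by
  obtain ⟨B, hmono, hfd, hdense⟩ := hA
  obtain ⟨n, -, hn⟩ := exists_forall_close hmono hdense G 0 (half_pos hη)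
  have := hfd n
  obtain ⟨e, heB, he, hel, -⟩ := exists_unit_of_finiteDimensional (B n)
  -- A unit of a larger `B n'` dominates `e`, but `α e` is only near `B n'`; `U` rotates it to a
  -- projection `f` in `B n'`. The loss is `9` for finding `f` and `20` for `U`, and `180 ≤ 400`.
  obtain ⟨n', hnn', hn'⟩ := exists_forall_close hmono hdense {α e} n (η := η / 400) (by positivity)
  obtain ⟨b, hb, hbe⟩ := hn' (α e) (by simp)
  have := hfd n'
  have hαe : IsStarProjection (α e) := he.map α
  obtain ⟨f, hfB, hf, hfe⟩ := exists_projection_near (B n') hαe hb (by linarith) hbe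
  obtain ⟨E, -, hE, hEl, -⟩ := exists_unit_of_finiteDimensional (B n')
  have hcoe : ∀ {p : A}, IsStarProjection p → IsStarProjection (p : Unitization ℂ A) :=
    fun {p} hp => hp.map (Unitization.inrNonUnitalStarAlgHom ℂ A)
  have hd : ‖(f : Unitization ℂ A) - (α e : A)‖ ≤ 9 * (η / 400) := by
    rw [← Unitization.inr_sub, Unitization.norm_inr]; exact hfe
  obtain ⟨U, hU, hUf, hU1⟩ := exists_unitary_conj_of_close_projections (hcoe hαe) (hcoe hf)
    (by linarith)
  have had : adOn U (α e) = f := by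
    apply Unitization.inr_injective (R := ℂ)
    rw [inr_adOn, hUf]
  have hunit : ∀ {p : A}, IsStarProjection p → ‖p‖ ≤ 1 := fun {p} hp => by
    rw [← Unitization.norm_inr (𝕜 := ℂ)]; exact (hcoe hp).norm_le_one
  have key : ∀ {p x c : A}, IsStarProjection p → ‖x - c‖ ≤ η / 2 → p * c = c →
      ‖p * x - x‖ ≤ η := fun {p x c} hp hxc hpc => by
    have h1 : p * x - x = p * (x - c) - (x - c) := by rw [mul_sub, hpc]; abel
    rw [h1]
    refine (norm_sub_le _ _).trans ?_
    have := norm_mul_le p (x - c)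
    nlinarith [hunit hp, norm_nonneg (x - c)]
  refine ⟨E, e, U, hU, hE, he, hEl _ (hmono hnn' heB), ?_, by linarith, ?_, ?_,
    fun x hx => ?_⟩
  · rw [had]; exact hEl _ hfB
  · rw [had]; exact hf
  · rw [had]; linarith
  · obtain ⟨c, hc, hxc⟩ := hn x hx
    refine ⟨key he hxc (hel c hc), key hE hxc (hEl c (hmono hnn' hc)), ?_⟩
    have h2 := key (x := star x) (c := star c) hE (by rw [← star_sub, norm_star]; exact hxc)
      (hEl _ (hmono hnn' (star_mem hc)))
    rwa [← norm_star, star_sub, star_mul, star_star, hE.isSelfAdjoint.star_eq] at h2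

theorem norm_adOn_sub_le {U : Unitization ℂ A} (hU : U ∈ unitary (Unitization ℂ A)) (a : A) :
    ‖adOn U a - a‖ ≤ 2 * ‖U - 1‖ * ‖a‖ := by
  rw [← Unitization.norm_inr (𝕜 := ℂ), Unitization.inr_sub, inr_adOn]
  have h1 : U * (a : Unitization ℂ A) * star U - a =
      ((U - 1) * (a : Unitization ℂ A) - (a : Unitization ℂ A) * (U - 1)) * star U := by
    have h2 := (Unitary.mem_iff.mp hU).2
    simp only [sub_mul, mul_sub, one_mul, mul_one, mul_assoc, h2]
    abel
  rw [h1]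
  refine (norm_mul_le _ _).trans ?_
  rw [norm_star, CStarRing.norm_of_mem_unitary hU, mul_one]
  refine (norm_commutator_le _ _).trans ?_
  rw [Unitization.norm_inr]

/-- Rohlin towers almost commuting with given elements, almost cyclically permuted by the
automorphism. -/
theorem HasRohlinProperty.exists_towers (hA : IsAFAlgebra A) {α : A ≃⋆ₐ[ℂ] A}
    (hα : HasRohlinProperty α) (k : ℕ) :
    ∃ (m : ℕ) (K : Fin m → ℕ), (∀ i, k ≤ K i) ∧ ∀ (G : Finset A) (δ : ℝ), 0 < δ →
      ∃ q : (Σ i, Fin (K i)) → A, (∀ a, IsStarProjection (q a)) ∧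
        (∀ a b, a ≠ b → q a * q b = 0) ∧
        (∀ x ∈ G, ‖x * ∑ a, q a - x‖ ≤ δ) ∧
        (∀ x ∈ G, ∀ a, ‖x * q a - q a * x‖ ≤ δ) ∧
        ∀ x ∈ G, ∀ a, ‖α (q a * x) - q (towerShift K a) * α x‖ ≤ δ := by
  classical
  obtain ⟨m, K, -, hK, h⟩ := hα k
  refine ⟨m, K, fun i => (hK i).2, fun G δ hδ => ?_⟩
  set M := ∑ g ∈ G, ‖g‖ with hM
  have hM0 : 0 ≤ M := Finset.sum_nonneg fun _ _ => norm_nonneg _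
  have hgM : ∀ g ∈ G, ‖g‖ ≤ M := fun g hg =>
    Finset.single_le_sum (f := fun g : A => ‖g‖) (fun _ _ => norm_nonneg _) hg
  -- Compressing `x` to `E * x * E` makes the commutator error `5 * η`; the shift error is `(2 + 4 *
  -- M) * η`, from replacing `x` by `e * x` and removing `Ad U`.
  obtain ⟨η, hη, hη1, hηδ⟩ : ∃ η > 0, η ≤ 1 ∧ η * (5 + 4 * M) ≤ δ := by
    refine ⟨min 1 (δ / (5 + 4 * M)), by positivity, min_le_left _ _, ?_⟩
    calc _ ≤ δ / (5 + 4 * M) * (5 + 4 * M) := by gcongr; exact min_le_right _ _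
      _ = δ := by field_simp
  obtain ⟨E, e, U, hU, hE, he, hEe, hEf, hU1, hf, hfe, hG⟩ :=
    exists_rohlin_corner hA α G hη hη1
  set f := adOn U (α e) with hfdef
  have hright : ∀ {p : A}, IsStarProjection p → E * p = p → p * E = p := fun {p} hp hEp => by
    have := congrArg star hEp
    rwa [star_mul, hp.isSelfAdjoint.star_eq, hE.isSelfAdjoint.star_eq] at this
  have hEE := hE.isIdempotentElem.eq
  have hcoe : ∀ {p : A}, IsStarProjection p → IsStarProjection (p : Unitization ℂ A) :=
    fun {p} hp => hp.map (Unitization.inrNonUnitalStarAlgHom ℂ A)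
  have hunit : ∀ {p : A}, IsStarProjection p → ‖p‖ ≤ 1 := fun {p} hp => by
    rw [← Unitization.norm_inr (𝕜 := ℂ)]; exact (hcoe hp).norm_le_one
  obtain ⟨p, hp0, hp, hpE, hpα, hpF⟩ := h E e U ({e, f} ∪ G.image fun x => E * x * E) η hE he hU
    (fun x hx => by
      simp only [Finset.mem_union, Finset.mem_insert, Finset.mem_singleton, Finset.mem_image] at hx
      rcases hx with (rfl | rfl) | ⟨y, -, rfl⟩
      · rw [hEe, hright he hEe]
      · rw [hEf, hright hf hEf]
      · rw [mul_assoc, mul_assoc, hEE, ← mul_assoc, ← mul_assoc, hEE])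
    hη hEe hEf (by simp) (by simp [hfdef])
  let q : (Σ i, Fin (K i)) → A := fun a => p a.1 a.2
  have hq : ∀ a, IsStarProjection (q a) := fun a => hp a.1 a.2 a.2.2
  have hqE : ∑ a, q a = E := by
    rw [← hpE, Fintype.sum_sigma]
    exact Finset.sum_congr rfl fun i _ => (Finset.sum_range (p i)).symm
  refine ⟨q, hq, fun a b hab => ?_, fun x hx => ?_, fun x hx a => ?_, fun x hx a => ?_⟩
  · apply Unitization.inr_injective (R := ℂ)
    rw [Unitization.inr_mul, Unitization.inr_zero]
    refine mul_eq_zero_of_isStarProjection_sum (p := fun a => (q a : Unitization ℂ A))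
      (fun a => hcoe (hq a)) ?_ hab
    have := map_sum (Unitization.inrHom ℂ ℂ A) q Finset.univ
    simp only [Unitization.inrHom_apply] at this
    rw [← this, hqE]
    exact hcoe hE
  · rw [hqE]
    exact (hG x hx).2.2.trans (by nlinarith)
  · have h1 := hpF a.1 a.2 a.2.2 (E * x * E) (by
      simp only [Finset.mem_union, Finset.mem_image]
      exact Or.inr ⟨x, hx, rfl⟩)
    have h2 : ‖x - E * x * E‖ ≤ 2 * η := by
      have h3 : x - E * x * E = -(E * (x * E - x)) - (E * x - x) := by
        rw [mul_sub, mul_assoc]; abel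
      rw [h3]
      refine (norm_sub_le _ _).trans ?_
      rw [norm_neg]
      have := norm_mul_le E (x * E - x)
      nlinarith [(hG x hx).2.1, (hG x hx).2.2, hunit hE, norm_nonneg (x * E - x)]
    have h3 := norm_commutator_le_add (q a) x (E * x * E)
    rw [norm_sub_rev, norm_sub_rev (q a * _)] at h3
    have h4 := hunit (hq a)
    change ‖E * x * E * q a - q a * (E * x * E)‖ < η at h1
    nlinarith [norm_nonneg (x - E * x * E)]
  · have hαn : ∀ y, ‖α y‖ ≤ ‖y‖ := fun y => NonUnitalStarAlgHom.norm_apply_le α y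
    have hqs : q (towerShift K a) = p a.1 (a.2 + 1) :=
      apply_finRotate_of_cyclic (p a.1) (hp0 a.1) a.2
    set q' := q (towerShift K a) with hq'
    have h1 := hpα a.1 a.2 a.2.2
    rw [← hqs] at h1
    change ‖adOn U (α (q a * e)) - q' * f‖ < η at h1
    have hqe : ‖q a * e‖ ≤ 1 := by
      refine (norm_mul_le _ _).trans ?_
      nlinarith [hunit (hq a), hunit he, norm_nonneg (q a), norm_nonneg e]
    have h2 := norm_adOn_sub_le hU (α (q a * e))
    have h2' : 2 * ‖U - 1‖ * ‖α (q a * e)‖ ≤ 2 * η := by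
      calc _ ≤ 2 * η * 1 := by
            gcongr
            exact (hαn _).trans hqe
        _ = 2 * η := mul_one _
    have hq'n := hunit (hq (towerShift K a))
    have h3 : ‖q' * f - q' * α e‖ ≤ η := by
      rw [← mul_sub]
      refine (norm_mul_le _ _).trans ?_
      nlinarith [norm_nonneg (f - α e)]
    have h4 : ‖α (q a * e) - q' * α e‖ ≤ 4 * η := by
      have e1 : α (q a * e) - q' * α e = -(adOn U (α (q a * e)) - α (q a * e)) +
        (adOn U (α (q a * e)) - q' * f) + (q' * f - q' * α e) := by abel
      rw [e1]
      have t1 := norm_add₃_le (a := -(adOn U (α (q a * e)) - α (q a * e)))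
        (b := adOn U (α (q a * e)) - q' * f) (c := q' * f - q' * α e)
      rw [norm_neg] at t1
      linarith
    have hex := (hG x hx).1
    have e2 : α (q a * x) - q' * α x = -(α (q a * (e * x - x))) +
        (α (q a * e) - q' * α e) * α x + q' * α (e * x - x) := by
      simp only [mul_sub, map_sub, sub_mul, map_mul, mul_assoc]; abel
    rw [e2]
    refine norm_add₃_le.trans ?_
    rw [norm_neg]
    have t1 : ‖α (q a * (e * x - x))‖ ≤ η := by
      refine (hαn _).trans ((norm_mul_le _ _).trans ?_)
      nlinarith [hunit (hq a), norm_nonneg (e * x - x)]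
    have t2 : ‖(α (q a * e) - q' * α e) * α x‖ ≤ 4 * η * M := by
      refine (norm_mul_le _ _).trans ?_
      gcongr
      exact (hαn x).trans (hgM x hx)
    have t3 : ‖q' * α (e * x - x)‖ ≤ η := by
      refine (norm_mul_le _ _).trans ?_
      have := hαn (e * x - x)
      nlinarith [norm_nonneg (α (e * x - x))]
    nlinarith

end Towers

/-! ### Gluing along almost central orthogonal projections -/

section OrthogonalProjections

variable {D : Type*} [CStarAlgebra D] {ι : Type*} [Fintype ι] {q : ι → D}

theorem norm_sum_le_card_mul {x : ι → D} {c : ℝ} (h : ∀ a, ‖x a‖ ≤ c) :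
    ‖∑ a, x a‖ ≤ Fintype.card ι * c := by
  simpa using norm_sum_le_of_le Finset.univ fun a _ => h a

/-- Moving each `q a` past `y b` costs `M * δ`, after which orthogonality leaves only the diagonal
terms. Gluing is thus almost multiplicative. -/
theorem norm_sum_mul_sum_sub_le (hq : ∀ a, IsStarProjection (q a))
    (hqo : ∀ a b, a ≠ b → q a * q b = 0) {x y : ι → D} {M δ : ℝ} (hM : 0 ≤ M)
    (hx : ∀ a, ‖x a‖ ≤ M) (hy : ∀ a b, ‖y b * q a - q a * y b‖ ≤ δ) :
    ‖(∑ a, x a * q a) * (∑ a, y a * q a) - ∑ a, x a * y a * q a‖ ≤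
      Fintype.card ι * (Fintype.card ι * (M * δ)) := by
  classical
  have h1 : (∑ a, x a * q a) * (∑ a, y a * q a) - ∑ a, x a * y a * q a =
      ∑ a, ∑ b, x a * ((q a * y b - y b * q a) * q b) := by
    have h2 : ∀ a, x a * y a * q a = ∑ b, x a * (y b * q a) * q b := fun a => by
      rw [Finset.sum_eq_single a, mul_assoc, mul_assoc, mul_assoc, (hq a).isIdempotentElem.eq]
      · intro b _ hba
        rw [mul_assoc, mul_assoc, hqo a b hba.symm, mul_zero, mul_zero]
      · simp
    simp only [h2, Finset.sum_mul_sum, ← Finset.sum_sub_distrib]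
    refine Finset.sum_congr rfl fun a _ => Finset.sum_congr rfl fun b _ => ?_
    noncomm_ring
  rw [h1]
  refine norm_sum_le_card_mul fun a => norm_sum_le_card_mul fun b => ?_
  have hδ : 0 ≤ δ := (norm_nonneg _).trans (hy a b)
  refine (norm_mul_le _ _).trans ?_
  refine mul_le_mul (hx a) ?_ (norm_nonneg _) hM
  refine (norm_mul_le _ _).trans ?_
  rw [norm_sub_rev]
  have := hy a b
  have h3 : ‖q b‖ ≤ 1 := (hq b).norm_le_one
  nlinarith [norm_nonneg (y b * q a - q a * y b)]

theorem norm_star_commutator {p : D} (hp : IsStarProjection p) (x : D) :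
    ‖star x * p - p * star x‖ = ‖x * p - p * x‖ := by
  rw [← norm_star, star_sub, star_mul, star_mul, star_star, hp.isSelfAdjoint.star_eq,
    norm_sub_rev]

theorem norm_star_sum_sub_le (hq : ∀ a, IsStarProjection (q a)) {x : ι → D} {δ : ℝ}
    (hx : ∀ a b, ‖x b * q a - q a * x b‖ ≤ δ) :
    ‖star (∑ a, x a * q a) - ∑ a, star (x a) * q a‖ ≤ Fintype.card ι * δ := by
  rw [star_sum, ← Finset.sum_sub_distrib]
  refine norm_sum_le_card_mul fun a => ?_
  rw [star_mul, (hq a).isSelfAdjoint.star_eq, norm_sub_rev, norm_star_commutator (hq a)]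
  exact hx a a

/-- If unitaries `1 + x a` almost commute with orthogonal projections `q a`, then
`1 + ∑ x a * q a` is almost unitary. -/
theorem almost_unitary_one_add_sum (hq : ∀ a, IsStarProjection (q a))
    (hqo : ∀ a b, a ≠ b → q a * q b = 0) {x : ι → D} {δ : ℝ}
    (hxu : ∀ a, 1 + x a ∈ unitary D) (hxn : ∀ a, ‖x a‖ ≤ 2)
    (hx : ∀ a b, ‖x b * q a - q a * x b‖ ≤ δ) {V : D} (hV : V = 1 + ∑ a, x a * q a) :
    ‖star V * V - 1‖ ≤ (Fintype.card ι + 4 * (Fintype.card ι : ℝ) ^ 2) * δ ∧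
      ‖V * star V - 1‖ ≤ (Fintype.card ι + 4 * (Fintype.card ι : ℝ) ^ 2) * δ := by
  set N : ℝ := (Fintype.card ι : ℝ) with hN
  have hN0 : 0 ≤ N := by positivity
  set s := ∑ a, x a * q a with hs
  set s' := ∑ a, star (x a) * q a with hs'
  have hsn : ‖s‖ ≤ N * 2 := norm_sum_le_card_mul fun a => by
    refine (norm_mul_le _ _).trans ?_
    have := (hq a).norm_le_one
    nlinarith [hxn a, norm_nonneg (x a)]
  have hss' : ‖star s - s'‖ ≤ N * δ := norm_star_sum_sub_le hq hx
  have h1 : ‖s' * s - ∑ a, star (x a) * x a * q a‖ ≤ N * (N * (2 * δ)) :=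
    norm_sum_mul_sum_sub_le hq hqo (by norm_num) (fun a => by rw [norm_star]; exact hxn a) hx
  have h2 : ‖s * s' - ∑ a, x a * star (x a) * q a‖ ≤ N * (N * (2 * δ)) :=
    norm_sum_mul_sum_sub_le hq hqo (by norm_num) hxn
      fun a b => (norm_star_commutator (hq a) _).trans_le (hx a b)
  -- Unitarity of `1 + x` reads `x + x⋆ + x⋆ x = 0`, and this holds block by block.
  have hu1 : s + s' + ∑ a, star (x a) * x a * q a = 0 := by
    rw [hs, hs', ← Finset.sum_add_distrib, ← Finset.sum_add_distrib]
    refine Finset.sum_eq_zero fun a _ => ?_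
    have := (Unitary.mem_iff.mp (hxu a)).1
    have e : x a + star (x a) + star (x a) * x a = star (1 + x a) * (1 + x a) - 1 := by
      rw [star_add, star_one]; noncomm_ring
    rw [← add_mul, ← add_mul, e, this, sub_self, zero_mul]
  have hu2 : s + s' + ∑ a, x a * star (x a) * q a = 0 := by
    rw [hs, hs', ← Finset.sum_add_distrib, ← Finset.sum_add_distrib]
    refine Finset.sum_eq_zero fun a _ => ?_
    have := (Unitary.mem_iff.mp (hxu a)).2
    have e : x a + star (x a) + x a * star (x a) = (1 + x a) * star (1 + x a) - 1 := by
      rw [star_add, star_one]; noncomm_ring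
    rw [← add_mul, ← add_mul, e, this, sub_self, zero_mul]
  have e1 : star V * V - 1 = (star s - s') + (star s - s') * s +
      (s' * s - ∑ a, star (x a) * x a * q a) := by
    have : star V * V - 1 = (star s - s') + (star s - s') * s +
      (s' * s - ∑ a, star (x a) * x a * q a) +
      (s + s' + ∑ a, star (x a) * x a * q a) := by
      rw [hV, star_add, star_one]; noncomm_ring
    rw [this, hu1, add_zero]
  have e2 : V * star V - 1 = (star s - s') + s * (star s - s') +
      (s * s' - ∑ a, x a * star (x a) * q a) := by
    have : V * star V - 1 = (star s - s') + s * (star s - s') +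
      (s * s' - ∑ a, x a * star (x a) * q a) +
      (s + s' + ∑ a, x a * star (x a) * q a) := by
      rw [hV, star_add, star_one]; noncomm_ring
    rw [this, hu2, add_zero]
  have e3 : N * δ + N * δ * (N * 2) + N * (N * (2 * δ)) = (N + 4 * N ^ 2) * δ := by ring
  have hNδ : 0 ≤ N * δ := (norm_nonneg _).trans hss'
  rw [← e3]
  constructor
  · rw [e1]
    refine norm_add₃_le.trans (add_le_add (add_le_add hss' ?_) h1)
    exact (norm_mul_le _ _).trans (by gcongr)
  · rw [e2]
    refine norm_add₃_le.trans (add_le_add (add_le_add hss' ?_) h2)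
    refine (norm_mul_le _ _).trans ?_
    rw [mul_comm]
    gcongr

/-- For the sum `y`, orthogonality gives `y⋆ y = ∑ q_a d_a⋆ q_a d_a q_a ≤ η² ∑ q_a ≤ η²`. The
triangle inequality would cost a factor equal to the number of levels, which is fatal when `η` is
about `π/k`. -/
theorem norm_sum_conj_le (hq : ∀ a, IsStarProjection (q a))
    (hqo : ∀ a b, a ≠ b → q a * q b = 0) {d : ι → D} {η : ℝ} (hη : 0 ≤ η) (hd : ∀ a, ‖d a‖ ≤ η) :
    ‖∑ a, q a * d a * q a‖ ≤ η := by
  classical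
  let : PartialOrder D := CStarAlgebra.spectralOrder D
  have : StarOrderedRing D := CStarAlgebra.spectralOrderedRing D
  set y := ∑ a, q a * d a * q a with hy
  have hqq := fun a => (hq a).isIdempotentElem.eq
  have hqs := fun a => (hq a).isSelfAdjoint.star_eq
  have hE : IsStarProjection (∑ a, q a) := by
    constructor
    · change (∑ a, q a) * (∑ a, q a) = _
      rw [Finset.sum_mul_sum]
      refine Finset.sum_congr rfl fun a _ => ?_
      rw [Finset.sum_eq_single a (fun b _ hb => hqo a b hb.symm) (by simp), hqq]
    · rw [IsSelfAdjoint, star_sum]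
      simp only [hqs]
  have h1 : star y * y = ∑ a, q a * (star (d a) * q a * d a) * q a := by
    rw [hy, star_sum, Finset.sum_mul_sum]
    refine Finset.sum_congr rfl fun a _ => ?_
    rw [Finset.sum_eq_single a]
    · simp only [star_mul, hqs, mul_assoc]
      rw [← mul_assoc (q a) (q a), hqq]
    · intro b _ hb
      rw [star_mul, hqs, ← mul_assoc, ← mul_assoc, star_mul, hqs, ← mul_assoc,
        mul_assoc _ (q a) (q b), hqo a b hb.symm]
      simp
    · simp
  have h2 : ∀ a, q a * (star (d a) * q a * d a) * q a ≤ η ^ 2 • q a := fun a => by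
    have hsa : IsSelfAdjoint (star (d a) * q a * d a) := by
      rw [IsSelfAdjoint, star_mul, star_mul, star_star, hqs, mul_assoc]
    have h3 := CStarAlgebra.star_left_conjugate_le_norm_smul (a := q a)
      (b := star (d a) * q a * d a) (hb := hsa)
    rw [hqs, hqq] at h3
    refine h3.trans (smul_le_smul_of_nonneg_right ?_ (hq a).nonneg)
    refine (norm_mul_le _ _).trans ?_
    have h4 := norm_mul_le (star (d a)) (q a)
    rw [norm_star] at h4
    have h5 := (hq a).norm_le_one
    have h6 : ‖star (d a) * q a‖ ≤ η := by
      nlinarith [hd a, norm_nonneg (d a)]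
    rw [pow_two]
    exact mul_le_mul h6 (hd a) (norm_nonneg _) hη
  have h3 : ‖star y * y‖ ≤ η ^ 2 := by
    have h4 : star y * y ≤ η ^ 2 • ∑ a, q a := by
      rw [h1, Finset.smul_sum]
      exact Finset.sum_le_sum fun a _ => h2 a
    refine (CStarAlgebra.norm_le_norm_of_nonneg_of_le (star_mul_self_nonneg y) h4).trans ?_
    rw [norm_smul, Real.norm_of_nonneg (by positivity)]
    exact mul_le_of_le_one_right (by positivity) hE.norm_le_one
  rw [CStarRing.norm_star_mul_self] at h3
  exact abs_le_of_sq_le_sq' (by nlinarith) hη |>.2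

/-- An almost block diagonal sum has almost the norm of its largest block. -/
theorem norm_sum_mul_le (hq : ∀ a, IsStarProjection (q a))
    (hqo : ∀ a b, a ≠ b → q a * q b = 0) {d : ι → D} {η δ : ℝ} (hη : 0 ≤ η)
    (hd : ∀ a, ‖d a‖ ≤ η) (hdq : ∀ a, ‖d a * q a - q a * d a‖ ≤ δ) :
    ‖∑ a, d a * q a‖ ≤ η + Fintype.card ι * δ := by
  have h1 : ∑ a, d a * q a = ∑ a, q a * d a * q a + ∑ a, (d a * q a - q a * d a) * q a := by
    rw [← Finset.sum_add_distrib]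
    refine Finset.sum_congr rfl fun a _ => ?_
    rw [sub_mul, mul_assoc (d a), (hq a).isIdempotentElem.eq]; abel
  rw [h1]
  refine (norm_add_le _ _).trans (add_le_add (norm_sum_conj_le hq hqo hη hd) ?_)
  refine norm_sum_le_card_mul fun a => (norm_mul_le _ _).trans ?_
  have := (hq a).norm_le_one
  nlinarith [hdq a, norm_nonneg (d a * q a - q a * d a)]

/-- The unitaries `1 + x a` glued along orthogonal projections almost solve `V = U β(V)`, if
`1 + x (σ a)` is close to `U β(1 + x a)` and `β` almost moves `q a` to `q (σ a)`. -/
theorem norm_sub_mul_map_one_add_sum_le [Nontrivial D] (hq : ∀ a, IsStarProjection (q a))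
    (hqo : ∀ a b, a ≠ b → q a * q b = 0) (σ : Equiv.Perm ι) (β : D →⋆ₐ[ℂ] D) {x : ι → D}
    {u U V : D} {η δ : ℝ} (hη : 0 ≤ η) (hU : U ∈ unitary D) (hUu : U = 1 + u)
    (hxu : ∀ a, 1 + x a ∈ unitary D) (hV : V = 1 + ∑ a, x a * q a)
    (hX : ∀ a, ‖(1 + x (σ a)) - U * β (1 + x a)‖ ≤ η)
    (huE : ‖u * ∑ a, q a - u‖ ≤ δ)
    (hxq : ∀ a b, ‖x b * q a - q a * x b‖ ≤ δ)
    (hβxq : ∀ a b, ‖β (x b) * q a - q a * β (x b)‖ ≤ δ)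
    (huq : ∀ a, ‖u * q a - q a * u‖ ≤ δ)
    (hβq : ∀ a, ‖β (q a * x a) - q (σ a) * β (x a)‖ ≤ δ) :
    ‖V - U * β V‖ ≤ η + (6 * Fintype.card ι + 1) * δ := by
  set N : ℝ := (Fintype.card ι : ℝ) with hN
  have hβn : ∀ y, ‖β y‖ ≤ ‖y‖ := fun y => NonUnitalStarAlgHom.norm_apply_le β y
  have hUn : ‖U‖ = 1 := CStarRing.norm_of_mem_unitary hU
  set d : ι → D := fun a => (1 + x (σ a)) - U * β (1 + x a) with hd
  -- The three terms are the block errors, the part of `u` not covered by the towers (where `V` is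
  -- `1`), and the failure of `β` to carry `q a` to `q (σ a)`. Only the first contributes `η`.
  have e1 : V - U * β V = ∑ a, d a * q (σ a) + (u * ∑ a, q a - u) +
      -(U * ∑ a, (β (x a * q a) - β (x a) * q (σ a))) := by
    have r1 : ∑ a, x a * q a = ∑ a, x (σ a) * q (σ a) :=
      (Equiv.sum_comp σ fun a => x a * q a).symm
    have r2 : ∑ a, q a = ∑ a, q (σ a) := (Equiv.sum_comp σ q).symm
    have r3 : ∀ a, d a * q (σ a) = x (σ a) * q (σ a) - U * (β (x a) * q (σ a)) - u * q (σ a) :=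
      fun a => by
        simp only [hd, map_add, map_one]
        rw [hUu]; noncomm_ring
    simp only [r3, Finset.sum_sub_distrib, ← Finset.mul_sum, ← r1, ← r2, ← map_sum]
    rw [hV, map_add, map_one, mul_sub, hUu]
    noncomm_ring
  have h1 : ‖∑ a, d a * q (σ a)‖ ≤ η + N * (3 * δ) := by
    refine norm_sum_mul_le (q := fun a => q (σ a)) (fun a => hq _)
      (fun a b hab => hqo _ _ fun h => hab (σ.injective h)) hη hX fun a => ?_
    have e2 : d a * q (σ a) - q (σ a) * d a = (x (σ a) * q (σ a) - q (σ a) * x (σ a)) +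
        -((u * q (σ a) - q (σ a) * u) * β (1 + x a)) +
        -(U * (β (x a) * q (σ a) - q (σ a) * β (x a))) := by
      simp only [hd, hUu, map_add, map_one]; noncomm_ring
    rw [e2]
    refine norm_add₃_le.trans ?_
    rw [norm_neg, norm_neg]
    have t1 := hxq (σ a) (σ a)
    have t2 : ‖(u * q (σ a) - q (σ a) * u) * β (1 + x a)‖ ≤ δ := by
      refine (norm_mul_le _ _).trans ?_
      have := (hβn (1 + x a)).trans (CStarRing.norm_of_mem_unitary (hxu a)).le
      nlinarith [huq (σ a), norm_nonneg (u * q (σ a) - q (σ a) * u)]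
    have t3 : ‖U * (β (x a) * q (σ a) - q (σ a) * β (x a))‖ ≤ δ := by
      refine (norm_mul_le _ _).trans ?_
      rw [hUn, one_mul]
      exact hβxq _ _
    linarith
  have h2 : ‖U * ∑ a, (β (x a * q a) - β (x a) * q (σ a))‖ ≤ N * (3 * δ) := by
    refine (norm_mul_le _ _).trans ?_
    rw [hUn, one_mul]
    refine norm_sum_le_card_mul fun a => ?_
    have e3 : β (x a * q a) - β (x a) * q (σ a) = β (x a * q a - q a * x a) +
        (β (q a * x a) - q (σ a) * β (x a)) + -(β (x a) * q (σ a) - q (σ a) * β (x a)) := by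
      rw [map_sub]; abel
    rw [e3]
    refine norm_add₃_le.trans ?_
    rw [norm_neg]
    have t1 := (hβn (x a * q a - q a * x a)).trans (hxq a a)
    linarith [hβq a, hβxq (σ a) a]
  rw [e1]
  refine norm_add₃_le.trans ?_
  rw [norm_neg]
  linarith

theorem norm_commutator_one_add_sum_le (hq : ∀ a, IsStarProjection (q a)) {x : ι → D}
    {b V : D} {κ δ : ℝ} (hV : V = 1 + ∑ a, x a * q a) (hxn : ∀ a, ‖x a‖ ≤ 2)
    (hbx : ∀ a, ‖b * x a - x a * b‖ ≤ κ) (hbq : ∀ a, ‖b * q a - q a * b‖ ≤ δ) :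
    ‖b * V - V * b‖ ≤ Fintype.card ι * (κ + 2 * δ) := by
  have h1 : b * V - V * b =
      ∑ a, ((b * x a - x a * b) * q a + x a * (b * q a - q a * b)) := by
    rw [hV, mul_add, add_mul, mul_one, one_mul, add_sub_add_left_eq_sub, Finset.mul_sum,
      Finset.sum_mul, ← Finset.sum_sub_distrib]
    refine Finset.sum_congr rfl fun a _ => ?_
    noncomm_ring
  rw [h1]
  refine norm_sum_le_card_mul fun a => (norm_add_le _ _).trans (add_le_add ?_ ?_)
  · refine (norm_mul_le _ _).trans ?_
    have := (hq a).norm_le_one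
    nlinarith [hbx a, norm_nonneg (b * x a - x a * b)]
  · exact (norm_mul_le _ _).trans (mul_le_mul (hxn a) (hbq a) (norm_nonneg _) (by norm_num))

end OrthogonalProjections

/-! ### The cocycle of a unitary and its correction over a tower -/

section Cocycles

variable {A : Type*} [NonUnitalCStarAlgebra A]

theorem unitizationExtension_inr (α : A ≃⋆ₐ[ℂ] A) (a : A) :
    unitizationExtension α (a : Unitization ℂ A) = ((α a : A) : Unitization ℂ A) :=
  Unitization.starMap_inr _ _

theorem fst_unitizationExtension (α : A ≃⋆ₐ[ℂ] A) (x : Unitization ℂ A) :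
    (unitizationExtension α x).fst = x.fst := by
  induction x using Unitization.ind with
  | inl_add_inr r a => simp [unitizationExtension, Unitization.algebraMap_eq_inl]

theorem unitizationExtension_mul (α γ : A ≃⋆ₐ[ℂ] A) (x : Unitization ℂ A) :
    unitizationExtension (α * γ) x = unitizationExtension α (unitizationExtension γ x) := by
  induction x using Unitization.ind with
  | inl_add_inr r a => simp [unitizationExtension, Unitization.algebraMap_eq_inl]

theorem unitizationExtension_one (x : Unitization ℂ A) :
    unitizationExtension (1 : A ≃⋆ₐ[ℂ] A) x = x := by
  induction x using Unitization.ind with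
  | inl_add_inr r a => simp [unitizationExtension, Unitization.algebraMap_eq_inl]

theorem unitizationExtension_inv_apply (α : A ≃⋆ₐ[ℂ] A) (x : Unitization ℂ A) :
    unitizationExtension α (unitizationExtension α⁻¹ x) = x := by
  rw [← unitizationExtension_mul, mul_inv_cancel, unitizationExtension_one]

theorem norm_unitizationExtension_le (α : A ≃⋆ₐ[ℂ] A) (x : Unitization ℂ A) :
    ‖unitizationExtension α x‖ ≤ ‖x‖ :=
  NonUnitalStarAlgHom.norm_apply_le (unitizationExtension α) x

theorem unitizationExtension_mem_unitary (α : A ≃⋆ₐ[ℂ] A) {x : Unitization ℂ A}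
    (hx : x ∈ unitary (Unitization ℂ A)) :
    unitizationExtension α x ∈ unitary (Unitization ℂ A) := by
  rw [Unitary.mem_iff] at hx ⊢
  rw [← map_star, ← map_mul, ← map_mul, hx.1, hx.2, map_one]
  exact ⟨rfl, rfl⟩

theorem norm_commutator_unitizationExtension_le (α : A ≃⋆ₐ[ℂ] A) (b : A)
    (x : Unitization ℂ A) :
    ‖(b : Unitization ℂ A) * unitizationExtension α x - unitizationExtension α x * b‖ ≤
      ‖((α⁻¹ b : A) : Unitization ℂ A) * x - x * (α⁻¹ b : A)‖ := by
  have hb : (b : Unitization ℂ A) = unitizationExtension α ((α⁻¹ b : A) : Unitization ℂ A) := by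
    rw [unitizationExtension_inr, ← StarAlgEquiv.mul_apply, mul_inv_cancel,
      StarAlgEquiv.one_apply]
  rw [hb]
  rw [← map_mul, ← map_mul, ← map_sub]
  exact norm_unitizationExtension_le _ _

theorem norm_commutator_mul_unitary_le {D : Type*} [CStarAlgebra D] [Nontrivial D] {b x y : D}
    (hx : x ∈ unitary D) (hy : y ∈ unitary D) :
    ‖b * (x * y) - x * y * b‖ ≤ ‖b * x - x * b‖ + ‖b * y - y * b‖ := by
  have h : b * (x * y) - x * y * b = (b * x - x * b) * y + x * (b * y - y * b) := by
    noncomm_ring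
  rw [h]
  refine (norm_add_le _ _).trans (add_le_add ?_ ?_) <;> refine (norm_mul_le _ _).trans ?_
  · rw [CStarRing.norm_of_mem_unitary hy, mul_one]
  · rw [CStarRing.norm_of_mem_unitary hx, one_mul]

theorem norm_commutator_star_unitary_le {D : Type*} [CStarAlgebra D] [Nontrivial D] {b x : D}
    (hx : x ∈ unitary D) : ‖b * star x - star x * b‖ ≤ ‖b * x - x * b‖ := by
  have hx' := Unitary.mem_iff.mp hx
  have h : b * star x - star x * b = -(star x * (b * x - x * b) * star x) := by
    rw [mul_sub, sub_mul, ← mul_assoc (star x) x, hx'.1, one_mul, ← mul_assoc, mul_assoc _ x,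
      hx'.2, mul_one]
    abel
  rw [h, norm_neg]
  refine (norm_mul_le _ _).trans ?_
  refine (mul_le_mul_of_nonneg_right (norm_mul_le _ _) (norm_nonneg _)).trans ?_
  rw [norm_star, CStarRing.norm_of_mem_unitary hx, one_mul, mul_one]

/-- The cocycle `U α(U) ⋯ α^(j-1)(U)` generated by `U`. -/
noncomputable def cocycle (α : A ≃⋆ₐ[ℂ] A) (U : Unitization ℂ A) : ℕ → Unitization ℂ A
  | 0 => 1
  | j + 1 => U * unitizationExtension α (cocycle α U j)

theorem cocycle_mem_unitary (α : A ≃⋆ₐ[ℂ] A) {U : Unitization ℂ A}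
    (hU : U ∈ unitary (Unitization ℂ A)) (j : ℕ) :
    cocycle α U j ∈ unitary (Unitization ℂ A) := by
  induction j with
  | zero => exact one_mem _
  | succ j ih => exact mul_mem hU (unitizationExtension_mem_unitary α ih)

theorem fst_cocycle (α : A ≃⋆ₐ[ℂ] A) {U : Unitization ℂ A} (hU : U.fst = 1) (j : ℕ) :
    (cocycle α U j).fst = 1 := by
  induction j with
  | zero => rfl
  | succ j ih => simp [cocycle, hU, ih, fst_unitizationExtension]

/-- The cocycle is the product of the `α^i(U)` for `i < j`, and the commutator of `c` with `α^i(U)`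
has the norm of that of `α^(-i)(c)` with `U`. -/
theorem norm_commutator_cocycle_le (α : A ≃⋆ₐ[ℂ] A) {U : Unitization ℂ A}
    (hU : U ∈ unitary (Unitization ℂ A)) {δ : ℝ} (j : ℕ) (c : A)
    (h : ∀ i < j, ‖(((α ^ i)⁻¹ c : A) : Unitization ℂ A) * U - U * ((α ^ i)⁻¹ c : A)‖ ≤ δ) :
    ‖(c : Unitization ℂ A) * cocycle α U j - cocycle α U j * c‖ ≤ j * δ := by
  induction j generalizing c with
  | zero => simp [cocycle]
  | succ j ih =>
    refine (norm_commutator_mul_unitary_le hU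
      (unitizationExtension_mem_unitary α (cocycle_mem_unitary α hU j))).trans ?_
    have h0 := h 0 (Nat.succ_pos j)
    simp only [pow_zero, inv_one, StarAlgEquiv.one_apply] at h0
    have h1 := ih (α⁻¹ c) fun i hi => by
      have := h (i + 1) (by omega)
      rwa [pow_succ', mul_inv_rev, StarAlgEquiv.mul_apply] at this
    have h2 := norm_commutator_unitizationExtension_le α c (cocycle α U j)
    push_cast
    linarith

/-- Over Rohlin towers, the cocycle of `U` corrected along paths `h i` from `1` to the inverse of
its value at the top of the tower almost solves `X (σ a) = U α(X a)`. -/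
theorem norm_tower_cocycle_sub_le (α : A ≃⋆ₐ[ℂ] A) {U : Unitization ℂ A}
    (hU : U ∈ unitary (Unitization ℂ A)) {m : ℕ} {K : Fin m → ℕ} {k : ℕ} (hk : 0 < k)
    (hK : ∀ i, k ≤ K i) {ε : ℝ} (h : Fin m → ℝ → Unitization ℂ A)
    (h0 : ∀ i, h i 0 = 1)
    (h1 : ∀ i, ‖h i 1 - unitizationExtension (α ^ K i)⁻¹ (star (cocycle α U (K i)))‖ ≤ ε)
    (hlip : ∀ i s t, ‖h i s - h i t‖ ≤ Real.pi * |s - t|)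
    {X : (Σ i, Fin (K i)) → Unitization ℂ A}
    (hX : ∀ a, X a = cocycle α U a.2 *
      unitizationExtension (α ^ (a.2 : ℕ)) (h a.1 ((a.2 : ℕ) / (K a.1 : ℝ))))
    (a : Σ i, Fin (K i)) :
    ‖X (towerShift K a) - U * unitizationExtension α (X a)‖ ≤ Real.pi / k + ε := by
  obtain ⟨i, j⟩ := a
  have hKi : 0 < K i := hk.trans_le (hK i)
  have hKR : (0 : ℝ) < K i := by exact_mod_cast hKi
  have hkR : (0 : ℝ) < k := by exact_mod_cast hk
  have hε : 0 ≤ ε := (norm_nonneg _).trans (h1 i)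
  have hπ : Real.pi * (1 / (K i : ℝ)) ≤ Real.pi / k := by
    rw [mul_one_div]
    have : (k : ℝ) ≤ K i := by exact_mod_cast hK i
    gcongr
  have hstep : |((j : ℕ) / (K i : ℝ)) - (((j : ℕ) + 1 : ℕ) / (K i : ℝ))| = 1 / (K i : ℝ) := by
    rw [← sub_div, abs_div, abs_of_pos hKR]
    push_cast
    norm_num
  have hUX : U * unitizationExtension α (X ⟨i, j⟩) = cocycle α U (j + 1) *
      unitizationExtension (α ^ ((j : ℕ) + 1)) (h i ((j : ℕ) / (K i : ℝ))) := by
    rw [hX, map_mul, ← mul_assoc, pow_succ', unitizationExtension_mul]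
    rfl
  have hcu := cocycle_mem_unitary α hU ((j : ℕ) + 1)
  rw [hUX, towerShift_apply]
  rcases Nat.lt_or_ge ((j : ℕ) + 1) (K i) with hj | hj
  · have hval : ((finRotate (K i) j : Fin (K i)) : ℕ) = j + 1 := by
      -- This function is the identity below `K i` and is cyclic, so evaluating it computes
      -- `finRotate`.
      have := apply_finRotate_of_cyclic (fun n => if n = K i then 0 else n)
        (by simp) j
      simp only [(finRotate (K i) j).2.ne, hj.ne, if_false] at this
      exact this
    rw [hX]
    simp only [hval]
    rw [← mul_sub, ← map_sub]
    refine (norm_mul_le _ _).trans ?_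
    rw [CStarRing.norm_of_mem_unitary hcu, one_mul]
    refine (norm_unitizationExtension_le _ _).trans ?_
    rw [norm_sub_rev]
    refine (hlip i _ _).trans ?_
    rw [hstep]
    linarith
  · have hjK : (j : ℕ) + 1 = K i := le_antisymm j.2 hj
    have hval : ((finRotate (K i) j : Fin (K i)) : ℕ) = 0 := by
      have := apply_finRotate_of_cyclic (fun n => if n = K i then 0 else n)
        (by simp) j
      simp only [(finRotate (K i) j).2.ne, hjK, if_true, if_false] at this
      exact this
    rw [hX]
    simp only [hval, hjK]
    rw [hjK] at hcu hstep
    rw [div_self hKR.ne'] at hstep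
    set c := cocycle α U (K i) with hc
    set θ := α ^ K i with hθ
    -- At the top the tower closes up: `1 = c θ(θ⁻¹(c⋆))`, so the error is one path step plus the
    -- endpoint error of `h`.
    have e1 : cocycle α U 0 * unitizationExtension (α ^ 0) (h i (((0 : ℕ) : ℝ) / (K i : ℝ))) -
        c * unitizationExtension θ (h i ((j : ℕ) / (K i : ℝ))) =
        c * unitizationExtension θ (unitizationExtension θ⁻¹ (star c) -
          h i ((j : ℕ) / (K i : ℝ))) := by
      rw [map_sub, unitizationExtension_inv_apply, mul_sub, (Unitary.mem_iff.mp hcu).2]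
      simp [h0, cocycle]
    rw [e1]
    refine (norm_mul_le _ _).trans ?_
    rw [CStarRing.norm_of_mem_unitary hcu, one_mul]
    refine (norm_unitizationExtension_le _ _).trans ?_
    rw [norm_sub_rev]
    have e2 := norm_add_le (h i ((j : ℕ) / (K i : ℝ)) - h i 1)
      (h i 1 - unitizationExtension θ⁻¹ (star c))
    rw [sub_add_sub_cancel] at e2
    have e3 := hlip i ((j : ℕ) / (K i : ℝ)) 1
    rw [hstep] at e3
    linarith [h1 i]

end Cocycles

/-! ### Assembly of the approximate coboundary -/

section Stability

variable {A : Type*} [NonUnitalCStarAlgebra A]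

/-- If `U` almost commutes with enough elements, then over towers of heights at least `k` there
are unitaries `X a`, almost commuting with given elements, that almost solve `X (σ a) = U α(X a)`. -/
theorem exists_tower_unitaries (hA : IsAFAlgebra A) (α : A ≃⋆ₐ[ℂ] A) {m : ℕ} {K : Fin m → ℕ}
    {k : ℕ} (hk : 0 < k) (hK : ∀ i, k ≤ K i) (G₁ : Finset A) {κ : ℝ} (hκ : 0 < κ) :
    ∃ (G₂ : Finset A) (δ : ℝ), 0 < δ ∧ ∀ U ∈ unitary (Unitization ℂ A), U.fst = 1 →
      (∀ g ∈ G₂, ‖(g : Unitization ℂ A) * U - U * g‖ ≤ δ) →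
      ∃ X : (Σ i, Fin (K i)) → Unitization ℂ A, (∀ a, X a ∈ unitary (Unitization ℂ A)) ∧
        (∀ a, (X a).fst = 1) ∧
        (∀ a, ‖X (towerShift K a) - U * unitizationExtension α (X a)‖ ≤ Real.pi / k + κ) ∧
        ∀ b ∈ G₁, ∀ a, ‖(b : Unitization ℂ A) * X a - X a * b‖ ≤ κ := by
  classical
  set K₀ := ∑ i, K i with hK₀
  have hKK₀ : ∀ i, K i ≤ K₀ := fun i =>
    Finset.single_le_sum (f := K) (fun _ _ => Nat.zero_le _) (Finset.mem_univ i)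
  let back : Finset A → Finset A := fun G =>
    (Finset.range (K₀ + 1) ×ˢ G).image fun p => (α ^ p.1)⁻¹ p.2
  have hback : ∀ {G : Finset A} {b : A} {j : ℕ}, b ∈ G → j ≤ K₀ → (α ^ j)⁻¹ b ∈ back G :=
    fun {G b j} hb hj => Finset.mem_image.mpr ⟨(j, b), by simp [hb]; omega, rfl⟩
  obtain ⟨G', δ', hδ', hpath⟩ :=
    exists_unitary_path_almost_commuting hA (back G₁) (half_pos hκ)
  -- The path needs `α^(-K)(U_K⋆)` to almost commute with `G'`, that is, `U_K` with `α^K(G')`. A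
  -- cocycle has at most `K₀` factors, whence the division by `K₀ + 1`.
  set Gc := G₁ ∪ (Finset.range (K₀ + 1) ×ˢ G').image fun p => (α ^ p.1) p.2 with hGc
  have hδ0 : (0 : ℝ) < min δ' (κ / 2) / (K₀ + 1) := by positivity
  refine ⟨back Gc, min δ' (κ / 2) / (K₀ + 1), hδ0, fun U hU hU1 hUG => ?_⟩
  set δ := min δ' (κ / 2) / (K₀ + 1) with hδ
  have hcu := cocycle_mem_unitary α hU
  have hc : ∀ c ∈ Gc, ∀ j ≤ K₀,
      ‖(c : Unitization ℂ A) * cocycle α U j - cocycle α U j * c‖ ≤ min δ' (κ / 2) := by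
    intro c hc j hj
    refine (norm_commutator_cocycle_le α hU j c fun i hi =>
      hUG _ (hback hc (hi.le.trans hj))).trans ?_
    have h1 : (j : ℝ) ≤ K₀ + 1 := by
      have : (j : ℝ) ≤ K₀ := by exact_mod_cast hj
      linarith
    calc (j : ℝ) * δ ≤ (K₀ + 1) * δ := by gcongr
      _ = min δ' (κ / 2) := by rw [hδ]; field_simp
  have hW : ∀ i, ∃ h : ℝ → Unitization ℂ A, (∀ t, h t ∈ unitary (Unitization ℂ A)) ∧
      (∀ t, (h t).fst = 1) ∧ h 0 = 1 ∧
      ‖h 1 - unitizationExtension (α ^ K i)⁻¹ (star (cocycle α U (K i)))‖ ≤ κ / 2 ∧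
      (∀ s t, ‖h s - h t‖ ≤ Real.pi * |s - t|) ∧
      ∀ g ∈ back G₁, ∀ t, ‖(g : Unitization ℂ A) * h t - h t * g‖ ≤ κ / 2 := by
    intro i
    refine hpath _ (unitizationExtension_mem_unitary _ (Unitary.star_mem (hcu _))) ?_
      fun g hg => ?_
    · rw [fst_unitizationExtension, Unitization.fst_star, fst_cocycle α hU1, star_one]
    · refine (norm_commutator_unitizationExtension_le _ _ _).trans ?_
      rw [inv_inv]
      refine (norm_commutator_star_unitary_le (hcu _)).trans ?_
      refine (hc _ ?_ _ (hKK₀ i)).trans (min_le_left _ _)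
      refine Finset.mem_union_right _ (Finset.mem_image.mpr ⟨(K i, g), ?_, rfl⟩)
      have := hKK₀ i
      simp [hg]
      omega
  choose h hu hfst h0 h1 hlip hcomm using hW
  refine ⟨fun a => cocycle α U a.2 *
    unitizationExtension (α ^ (a.2 : ℕ)) (h a.1 ((a.2 : ℕ) / (K a.1 : ℝ))), fun a => ?_,
    fun a => ?_, fun a => ?_, fun b hb a => ?_⟩
  · exact mul_mem (hcu _) (unitizationExtension_mem_unitary _ (hu _ _))
  · rw [Unitization.fst_mul, fst_unitizationExtension, fst_cocycle α hU1, hfst, one_mul]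
  · refine (norm_tower_cocycle_sub_le α hU hk hK h h0 h1 hlip (fun _ => rfl) a).trans ?_
    linarith
  · have hj : (a.2 : ℕ) ≤ K₀ := a.2.2.le.trans (hKK₀ a.1)
    refine (norm_commutator_mul_unitary_le (hcu _)
      (unitizationExtension_mem_unitary _ (hu _ _))).trans ?_
    have t1 := (hc b (Finset.mem_union_left _ hb) _ hj).trans (min_le_right _ _)
    have t2 := (norm_commutator_unitizationExtension_le (α ^ (a.2 : ℕ)) b
      (h a.1 ((a.2 : ℕ) / (K a.1 : ℝ)))).trans (hcomm a.1 _ (hback hb hj) _)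
    linarith

theorem Unitization.inr_sum {ι : Type*} (s : Finset ι) (f : ι → A) :
    ((∑ i ∈ s, f i : A) : Unitization ℂ A) = ∑ i ∈ s, (f i : Unitization ℂ A) := by
  simpa only [Unitization.inrHom_apply] using map_sum (Unitization.inrHom ℂ ℂ A) f s

theorem norm_inr_commutator (a b : A) :
    ‖(a : Unitization ℂ A) * b - b * a‖ = ‖a * b - b * a‖ := by
  rw [← Unitization.inr_mul, ← Unitization.inr_mul, ← Unitization.inr_sub, Unitization.norm_inr]

/-- Gluing unitaries along Rohlin towers. -/
theorem exists_glued_unitary {α : A ≃⋆ₐ[ℂ] A} {m : ℕ} {K : Fin m → ℕ}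
    (htowers : ∀ (G : Finset A) (δ : ℝ), 0 < δ →
      ∃ q : (Σ i, Fin (K i)) → A, (∀ a, IsStarProjection (q a)) ∧
        (∀ a b, a ≠ b → q a * q b = 0) ∧
        (∀ x ∈ G, ‖x * ∑ a, q a - x‖ ≤ δ) ∧
        (∀ x ∈ G, ∀ a, ‖x * q a - q a * x‖ ≤ δ) ∧
        ∀ x ∈ G, ∀ a, ‖α (q a * x) - q (towerShift K a) * α x‖ ≤ δ)
    {U : Unitization ℂ A} (hU : U ∈ unitary (Unitization ℂ A)) (hU1 : U.fst = 1)
    {X : (Σ i, Fin (K i)) → Unitization ℂ A} (hXu : ∀ a, X a ∈ unitary (Unitization ℂ A))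
    (hX1 : ∀ a, (X a).fst = 1) {η κ δ : ℝ} (hη : 0 ≤ η) (hδ : 0 < δ)
    (hX : ∀ a, ‖X (towerShift K a) - U * unitizationExtension α (X a)‖ ≤ η)
    (G₁ : Finset A) (hG₁ : ∀ b ∈ G₁, ∀ a, ‖(b : Unitization ℂ A) * X a - X a * b‖ ≤ κ) :
    ∃ V : Unitization ℂ A, V.fst = 1 ∧ ‖star V * V - 1‖ ≤ δ ∧ ‖V * star V - 1‖ ≤ δ ∧
      ‖V - U * unitizationExtension α V‖ ≤ η + δ ∧
      ∀ b ∈ G₁, ‖(b : Unitization ℂ A) * V - V * b‖ ≤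
        Fintype.card (Σ i, Fin (K i)) * κ + δ := by
  classical
  set N : ℝ := (Fintype.card (Σ i, Fin (K i)) : ℝ) with hN
  have hN0 : 0 ≤ N := by positivity
  set γ := δ / (1 + 6 * N + 4 * N ^ 2) with hγ
  have hγ0 : 0 < γ := by positivity
  have hγδ : γ * (1 + 6 * N + 4 * N ^ 2) = δ := by rw [hγ]; field_simp
  have hNγ : 0 ≤ N * γ := by positivity
  have hNγ2 : 0 ≤ N ^ 2 * γ := by positivity
  let x : (Σ i, Fin (K i)) → A := fun a => (X a).snd
  have hXx : ∀ a, X a = 1 + (x a : Unitization ℂ A) := fun a => by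
    rw [add_comm]; exact eq_inr_snd_add_one (hX1 a)
  -- The projections are chosen after the `X a`, so they can almost commute with these, their images
  -- under `α` and `U`. The denominator of `γ` absorbs all the coefficients in `N`.
  obtain ⟨q, hq, hqo, hqG, hqc, hqα⟩ := htowers
    ({U.snd} ∪ Finset.univ.image x ∪ (Finset.univ.image fun a => α (x a)) ∪ G₁) γ hγ0
  have hmx : ∀ a, x a ∈ {U.snd} ∪ Finset.univ.image x ∪
      (Finset.univ.image fun a => α (x a)) ∪ G₁ := fun a => by simp
  have hmα : ∀ a, α (x a) ∈ {U.snd} ∪ Finset.univ.image x ∪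
      (Finset.univ.image fun a => α (x a)) ∪ G₁ := fun a => by simp
  have hmU : U.snd ∈ {U.snd} ∪ Finset.univ.image x ∪
      (Finset.univ.image fun a => α (x a)) ∪ G₁ := by simp
  let Q : (Σ i, Fin (K i)) → Unitization ℂ A := fun a => (q a : Unitization ℂ A)
  let Y : (Σ i, Fin (K i)) → Unitization ℂ A := fun a => (x a : Unitization ℂ A)
  have hQ : ∀ a, IsStarProjection (Q a) := fun a =>
    (hq a).map (Unitization.inrNonUnitalStarAlgHom ℂ A)
  have hQo : ∀ a b, a ≠ b → Q a * Q b = 0 := fun a b hab => by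
    simp only [Q]
    rw [← Unitization.inr_mul, hqo a b hab, Unitization.inr_zero]
  have hYu : ∀ a, 1 + Y a ∈ unitary (Unitization ℂ A) := fun a => by
    rw [← hXx a]; exact hXu a
  have hYn : ∀ a, ‖Y a‖ ≤ 2 := fun a => by
    have := norm_sub_le (1 + Y a) 1
    rw [add_sub_cancel_left, CStarRing.norm_of_mem_unitary (hYu a), CStarRing.norm_one] at this
    linarith
  have hYQ : ∀ a b, ‖Y b * Q a - Q a * Y b‖ ≤ γ := fun a b => by
    rw [norm_inr_commutator]; exact hqc _ (hmx b) a
  set V : Unitization ℂ A := 1 + ∑ a, Y a * Q a with hV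
  obtain ⟨hV1, hV2⟩ := almost_unitary_one_add_sum hQ hQo hYu hYn hYQ hV
  rw [← hN] at hV1 hV2
  have hcoef : (N + 4 * N ^ 2) * γ ≤ δ := by nlinarith
  refine ⟨V, ?_, hV1.trans hcoef, hV2.trans hcoef, ?_, fun b hb => ?_⟩
  · have h1 : V = 1 + ((∑ a, x a * q a : A) : Unitization ℂ A) := by
      rw [hV, Unitization.inr_sum]
      simp only [Unitization.inr_mul, Y, Q]
    rw [h1]; simp
  · have h1 := norm_sub_mul_map_one_add_sum_le hQ hQo (towerShift K) (unitizationExtension α)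
      (u := (U.snd : Unitization ℂ A)) (η := η) (δ := γ) hη hU
      (by rw [add_comm]; exact eq_inr_snd_add_one hU1) hYu hV
      (fun a => by rw [← hXx, ← hXx]; exact hX a)
      (by
        simp only [Q]
        rw [← Unitization.inr_sum, ← Unitization.inr_mul, ← Unitization.inr_sub,
          Unitization.norm_inr]
        exact hqG _ hmU) hYQ
      (fun a b => by
        simp only [Y, Q]
        rw [unitizationExtension_inr, norm_inr_commutator]
        exact hqc _ (hmα b) a)
      (fun a => by
        rw [norm_inr_commutator]
        exact hqc _ hmU a)
      (fun a => by
        simp only [Y, Q]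
        rw [← Unitization.inr_mul, unitizationExtension_inr, unitizationExtension_inr,
          ← Unitization.inr_mul, ← Unitization.inr_sub, Unitization.norm_inr]
        exact hqα _ (hmx a) a)
    rw [← hN] at h1
    nlinarith
  · have h1 := norm_commutator_one_add_sum_le hQ hV hYn (b := (b : Unitization ℂ A)) (κ := κ)
      (δ := γ) (fun a => by
        have h2 : (b : Unitization ℂ A) * Y a - Y a * b = b * X a - X a * b := by
          rw [hXx]; simp only [Y]; noncomm_ring
        rw [h2]; exact hG₁ b hb a)
      (fun a => by
        rw [norm_inr_commutator]
        exact hqc _ (by simp [hb]) a)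
    rw [← hN] at h1
    nlinarith

/-- A form of the stability theorem for unitaries almost commuting with finitely many elements. -/
theorem exists_coboundary_of_almost_commuting (hA : IsAFAlgebra A) {α : A ≃⋆ₐ[ℂ] A}
    (hα : HasRohlinProperty α) {ε : ℝ} (hε : 0 < ε) (B : NonUnitalStarSubalgebra ℂ A)
    [FiniteDimensional ℂ B] :
    ∃ (G : Finset A) (δ : ℝ), 0 < δ ∧ ∀ U ∈ unitary (Unitization ℂ A), U.fst = 1 →
      (∀ g ∈ G, ‖(g : Unitization ℂ A) * U - U * g‖ ≤ δ) →
      ∃ V ∈ unitariesOnePlusCommutant B, ‖U - V * unitizationExtension α (star V)‖ < ε := by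
  obtain ⟨G₁, δ₁, hδ₁, hpert⟩ := exists_unitary_in_commutant_near B (ε := ε / 8) (by positivity)
  obtain ⟨k, hk0, hk⟩ : ∃ k : ℕ, 0 < k ∧ Real.pi / k ≤ ε / 4 := by
    obtain ⟨k, hk⟩ := exists_nat_gt (Real.pi / (ε / 4))
    have hk0 : (0 : ℝ) < k := lt_trans (by positivity) hk
    refine ⟨k, by exact_mod_cast hk0, ?_⟩
    rw [div_lt_iff₀ (by positivity)] at hk
    rw [div_le_iff₀ hk0]
    linarith
  obtain ⟨m, K, hK, htowers⟩ := hα.exists_towers hA k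
  set N : ℝ := (Fintype.card (Σ i, Fin (K i)) : ℝ) with hN
  -- `κ` may depend on the number `N` of levels, already fixed by `k`. The final budget is `ε/4` for
  -- `π/k` and `ε/8` each for `κ`, the gluing and the two replacements of `V` by `W`: `3ε/4` in all.
  set κ := min (ε / 8) (δ₁ / (2 * (N + 1))) with hκ
  have hN0 : 0 ≤ N := by positivity
  have hκ0 : 0 < κ := by positivity
  have hκN : N * κ ≤ δ₁ / 2 := by
    have h1 : κ ≤ δ₁ / (2 * (N + 1)) := min_le_right _ _
    rw [le_div_iff₀ (by positivity)] at h1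
    nlinarith
  obtain ⟨G₂, δ₂, hδ₂, hX⟩ := exists_tower_unitaries hA α hk0 hK G₁ hκ0
  refine ⟨G₂, δ₂, hδ₂, fun U hU hU1 hUG => ?_⟩
  obtain ⟨X, hXu, hX1, hXs, hXc⟩ := hX U hU hU1 hUG
  obtain ⟨V, hV1, hVV, hVV', hVU, hVc⟩ := exists_glued_unitary htowers hU hU1 hXu hX1
    (η := Real.pi / k + κ) (δ := min (ε / 8) (δ₁ / 2)) (by positivity) (by positivity) hXs G₁ hXc
  have hm1 : min (ε / 8) (δ₁ / 2) ≤ ε / 8 := min_le_left _ _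
  have hm2 : min (ε / 8) (δ₁ / 2) ≤ δ₁ / 2 := min_le_right _ _
  obtain ⟨W, hW, hW1, hWB, hWV, -⟩ := hpert V hV1 (by linarith) (by linarith)
    (fun g hg => (hVc g hg).trans (by linarith))
  refine ⟨W, ⟨hW, W.snd, fun b hb => ?_, eq_inr_snd_add_one hW1⟩, ?_⟩
  · have h1 : (b : Unitization ℂ A) * W = W * b := hWB b hb
    rw [eq_inr_snd_add_one hW1, mul_add, add_mul, mul_one, one_mul, add_left_inj,
      ← Unitization.inr_mul, ← Unitization.inr_mul] at h1
    exact Unitization.inr_injective h1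
  · have hβW := unitizationExtension_mem_unitary α hW
    have e1 : U - W * unitizationExtension α (star W) =
        (U * unitizationExtension α W - W) * star (unitizationExtension α W) := by
      rw [sub_mul, mul_assoc, (Unitary.mem_iff.mp hβW).2, mul_one, map_star]
    have e2 : U * unitizationExtension α W - W = U * unitizationExtension α (W - V) +
        -(V - U * unitizationExtension α V) + -(W - V) := by
      rw [map_sub, mul_sub]; abel
    have t1 : ‖U * unitizationExtension α (W - V)‖ ≤ ε / 8 := by
      refine (norm_mul_le _ _).trans ?_
      rw [CStarRing.norm_of_mem_unitary hU, one_mul]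
      exact (norm_unitizationExtension_le _ _).trans hWV
    have t2 : ‖U * unitizationExtension α W - W‖ ≤
        ε / 8 + (Real.pi / k + κ + min (ε / 8) (δ₁ / 2)) + ε / 8 := by
      rw [e2]
      refine norm_add₃_le.trans ?_
      rw [norm_neg, norm_neg]
      linarith
    rw [e1]
    refine (norm_mul_le _ _).trans_lt ?_
    rw [norm_star, CStarRing.norm_of_mem_unitary hβW, mul_one]
    have hκε : κ ≤ ε / 8 := min_le_left _ _
    linarith

end Stability

theorem theorem3p1 {A : Type*} [NonUnitalCStarAlgebra A] (hA : IsAFAlgebra A)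
    (α : A ≃⋆ₐ[ℂ] A) (hα : HasRohlinProperty α)
    (ε : ℝ) (hε : 0 < ε)
    (B₁ : NonUnitalStarSubalgebra ℂ A) (hB₁ : FiniteDimensional ℂ B₁) :
    ∃ B₂ : NonUnitalStarSubalgebra ℂ A, FiniteDimensional ℂ B₂ ∧
      ∀ U ∈ unitariesOnePlusCommutant B₂, ∃ V ∈ unitariesOnePlusCommutant B₁,
        ‖U - V * unitizationExtension α (star V)‖ < ε := by
  obtain ⟨G, δ, hδ, h⟩ := exists_coboundary_of_almost_commuting hA hα hε B₁
  obtain ⟨B, hmono, hfd, hdense⟩ := hA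
  obtain ⟨n, -, hn⟩ := exists_forall_close hmono hdense G 0 (half_pos hδ)
  -- Each `g` in `G` is within `δ / 2` of `B n`, so exact commutation with `B n` bounds its
  -- commutator with the unitary `U` by `δ`.
  refine ⟨B n, hfd n, fun U ⟨hU, a, ha, hUa⟩ => h U hU (by simp [hUa]) fun g hg => ?_⟩
  obtain ⟨b, hb, hgb⟩ := hn g hg
  have hc : Commute (b : Unitization ℂ A) U := by
    have h1 : (b : Unitization ℂ A) * a = a * b := by
      rw [← Unitization.inr_mul, ← Unitization.inr_mul, ha b hb]
    rw [hUa]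
    exact Commute.add_right h1 (Commute.one_right _)
  refine (norm_inr_commutator_le_of_close hU hc).trans ?_
  linarith
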